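/- For $m\in\mathbb N$ let $\langle m\rangle=\{-\lfloor m/2\rfloor,\dots,\lfloor m/2\rfloor\}\subset\mathbb Z$, and let $\log$ denote the logarithm to base $2$. The $k$-Tree algorithm over the integers has parameters $k,n,m\in\mathbb N$, with $k$ a power of $2$, and $p\in(0,1]$. Its input is $k$ lists $L_1,\dots,L_k$ of $n$ integers each. It sets $L^0_i=L_i$ for $1\le i\le k$ and, successively for $d=1,\dots,\log k$ and $1\le i\le k/2^d$, it lets $L^d_i$ be the list of all sums $a+b$ with $a\in L^{d-1}_{2i-1}$, $b\in L^{d-1}_{2i}$ and $|a+b|\le p^d m/2$, with one copy of the sum for every such pair of entries (duplicates are kept). If $L^{\log k}_1$ contains $0$, it outputs the indices $(\ell_1,\dots,\ell_k)\in\{1,\dots,n\}^k$ of the input elements that led to this sum; otherwise it outputs $\bot$. The algorithm succeeds if it outputs some $(\ell_1,\dots,\ell_k)$ such that $\sum_i L_i[\ell_i]=0$. The total list size of an execution is $\sum_{d=0}^{\log k}\sum_{i=1}^{k/2^d}|L^d_i|$ (input lists included). **Theorem.** Let $k,n,m$ be positive integers such that $k\ge 4$ is a power of $2$ and $m>30^{\log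 k+1}$. Set $p=m^{-1/(\log k+1)}$ and $c=pn$. Let $L_1,\dots,L_k$ be lists of $n$ integers each, all $kn$ entries being independent and uniformly distributed on $\langle m\rangle$. Then the $k$-Tree algorithm over the integers with parameters $k,n,m,p$ satisfies $$\frac{\max(0,\,1-150p)^k}{c^{-k}+\left(1+\frac kn\right)^k}\;\le\;\Pr[\text{the algorithm succeeds}]\;\le\;c^k(1+37p)^k ,$$ and, writing $S=1+\sum_{d=1}^{\log k}\frac{c^{2^d-1}}{2^d}$, its expected total list size $E$ is finite and satisfies $$kn\,S\,(1-37p)^{k-1}\;\le\; E\;\le\; kn\,S\,(1+37p)^{k-1}.$$ -/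

import Mathlib

namespace KTree

/-- An entry of a list at level `d`: an integer, together with the indices (one in each of the
`2 ^ d` input lists below it) of the input elements that were added up to obtain it. -/
structure Entry (n d : ℕ) where
  /-- the indices of the contributing input elements -/
  idx : Fin (2 ^ d) → Fin n
  /-- the integer stored in the list -/
  val : ℤ

/-- The entry `a + b`; the index tuple of `a` is followed by that of `b`. -/
def Entry.add {n d : ℕ} (a b : Entry n d) : Entry n (d + 1) where
  idx := fun j => Fin.append a.idx b.idx (Fin.cast (by rw [pow_succ, mul_two]) j)
  val := a.val + b.val

/-- `Merge(A, B, τ)`: the list of all `a + b` with `a ∈ A`, `b ∈ B`, `|a + b| ≤ τ`,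
with one copy for each such pair of list positions (duplicates are kept). -/
noncomputable def merge {n d : ℕ} (A B : List (Entry n d)) (τ : ℝ) : List (Entry n (d + 1)) :=
  ((A ×ˢ B).filter fun ab => ((|ab.1.val + ab.2.val| : ℤ) : ℝ) ≤ τ).map fun ab => ab.1.add ab.2

/-- The threshold in iteration `d`: it starts as `m / 2` and is multiplied by `p` in each
iteration. -/
noncomputable def threshold (m : ℕ) (p : ℝ) : ℕ → ℝ
  | 0 => (m : ℝ) / 2
  | d + 1 => p * threshold m p d

/-- The lists of the `k`-Tree algorithm with `k = 2 ^ t`, on input `L`, where `L i j` is the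
`j`-th element of the `i`-th list. `level m p L d i` is the `i`-th list at level `d`; lists are
counted from `0`, so that it is formed from the lists `2 * i` and `2 * i + 1` of the previous
level. The algorithm has `k / 2 ^ d` lists at level `d`; indices beyond are not used. -/
noncomputable def level {t n : ℕ} (m : ℕ) (p : ℝ) (L : Fin (2 ^ t) → Fin n → ℤ) :
    (d : ℕ) → ℕ → List (Entry n d)
  | 0, i => if h : i < 2 ^ t then List.ofFn fun j => ⟨fun _ => j, L ⟨i, h⟩ j⟩ else []
  | d + 1, i =>
      merge (level m p L d (2 * i)) (level m p L d (2 * i + 1)) (threshold m p (d + 1))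

/-- The `k`-Tree algorithm over the integers, `k = 2 ^ t`: if the list at level `t = log k`
contains `0`, output the indices that led to (the first occurrence of) this sum; otherwise output
the failure symbol `none`. -/
noncomputable def ktree {t n : ℕ} (m : ℕ) (p : ℝ) (L : Fin (2 ^ t) → Fin n → ℤ) :
    Option (Fin (2 ^ t) → Fin n) :=
  ((level m p L t 0).find? fun e => e.val = 0).map Entry.idx

/-- The algorithm outputs indices `ℓ₁, …, ℓₖ` such that `∑ i, L i (ℓ i) = 0`. -/
def Succeeds {t n : ℕ} (m : ℕ) (p : ℝ) (L : Fin (2 ^ t) → Fin n → ℤ) : Prop :=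
  ∃ l : Fin (2 ^ t) → Fin n, ktree m p L = some l ∧ ∑ i, L i (l i) = 0

/-- The total size of all lists, the input lists included, involved in the execution on `L`. -/
noncomputable def totalSize {t n : ℕ} (m : ℕ) (p : ℝ) (L : Fin (2 ^ t) → Fin n → ℤ) : ℕ :=
  ∑ d ∈ Finset.range (t + 1), ∑ i ∈ Finset.range (2 ^ t / 2 ^ d), (level m p L d i).length

/-- The integers `-⌊m / 2⌋, …, ⌊m / 2⌋`. -/
def intRange (m : ℕ) : Set ℤ := Set.Icc (-((m / 2 : ℕ) : ℤ)) ((m / 2 : ℕ) : ℤ)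

end KTree

/-! ### Multiplicities of values in merged lists -/

namespace KTree

open Finset

/-! Let `X(x)` count the entries of value `x` in a list at level `d`. Within the next window, the
count of a parent list is the convolution of the counts of its two children, which depend on
disjoint input lists and are therefore independent. Hence first moments convolve too: about `p^d m`
integers lie in the window, so a density `δ` turns into about `δ² p^d m`, with solution `c^(2^d) /
(p^(d+1) m)`. Rounding and window boundaries cost only powers of `1 + O(p)` (`integral_count_le`,
`le_integral_count`). Summing over a window gives list sizes near `n c^(2^d - 1)`, hence `E`. As
`p^(t+1) m = 1`, the last list has about `c^k` zeros on average, and this bounds the success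
probability from above.

The lower bound is the second moment method. Its core is `integral_count_mul_le`, which proves
`E[X(x) X(y)] ≤ α + [x = y] E[X(x)]`. The diagonal term, due to equal index tuples, reproduces
itself under convolution, so only mixed terms make `α / δ²` grow. That growth is the recursion
`pairRatio`, solved separately for `c ≥ 1` and `c ≤ 1`; `pairRatio_add_le` joins the two cases into
`c^(-k) + (1 + k/n)^k`. -/

/-- The number of entries of a list that have the value `x`. -/
noncomputable def mult {n d : ℕ} (l : List (Entry n d)) (x : ℤ) : ℕ :=
  l.countP fun e => e.val = x

theorem mult_eq_zero {n d : ℕ} {l : List (Entry n d)} {x : ℤ} :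
    mult l x = 0 ↔ ∀ e ∈ l, e.val ≠ x := by
  simp [mult, List.countP_eq_zero]

theorem mult_pos {n d : ℕ} {l : List (Entry n d)} {x : ℤ} :
    0 < mult l x ↔ ∃ e ∈ l, e.val = x := by
  simp [mult, List.countP_pos_iff]

theorem mult_le_length {n d : ℕ} (l : List (Entry n d)) (x : ℤ) : mult l x ≤ l.length :=
  List.countP_le_length

theorem sum_mult {n d : ℕ} (l : List (Entry n d)) (J : Finset ℤ) (h : ∀ e ∈ l, e.val ∈ J) :
    ∑ x ∈ J, mult l x = l.length := by
  induction l with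
  | nil => simp [mult]
  | cons a l ih =>
    have h1 := ih fun e he => h e (List.mem_cons_of_mem _ he)
    simp only [mult] at h1 ⊢
    simp [List.countP_cons, Finset.sum_add_distrib, h1, h a]

theorem countP_product {n d : ℕ} (A B : List (Entry n d)) (J : Finset ℤ)
    (hA : ∀ e ∈ A, e.val ∈ J) (x : ℤ) :
    (A ×ˢ B).countP (fun ab => ab.1.val + ab.2.val = x)
      = ∑ y ∈ J, mult A y * mult B (x - y) := by
  induction A with
  | nil => simp [mult]
  | cons a A ih =>
    have h1 := ih fun e he => hA e (List.mem_cons_of_mem _ he)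
    have h2 : (B.map (Prod.mk a)).countP (fun ab => ab.1.val + ab.2.val = x)
        = mult B (x - a.val) := by
      simp only [mult, List.countP_map]
      congr 1
      funext b
      simp [eq_sub_iff_add_eq']
    have h3 : ∀ y, mult (a :: A) y = mult A y + if a.val = y then 1 else 0 := by
      intro y
      simp [mult, List.countP_cons]
    rw [List.product_cons, List.countP_append, h1, h2]
    simp_rw [h3, add_mul]
    rw [Finset.sum_add_distrib, add_comm]
    simp [hA a]

/-- Grouping pairs by the value of the summand from `A` turns merging into convolution followed by
truncation. The set `J` only serves to make the sum finite. -/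
theorem mult_merge {n d : ℕ} (A B : List (Entry n d)) (J : Finset ℤ)
    (hA : ∀ e ∈ A, e.val ∈ J) (τ : ℝ) (x : ℤ) :
    mult (merge A B τ) x
      = if ((|x| : ℤ) : ℝ) ≤ τ then ∑ y ∈ J, mult A y * mult B (x - y) else 0 := by
  have h0 : mult (merge A B τ) x = (A ×ˢ B).countP
      (fun ab => ab.1.val + ab.2.val = x ∧ ((|ab.1.val + ab.2.val| : ℤ) : ℝ) ≤ τ) := by
    simp [mult, merge, List.countP_map, List.countP_filter, Function.comp_def, Entry.add]
  rw [h0]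
  split_ifs with h
  · rw [← countP_product A B J hA]
    congr 1
    funext ab
    simp only [decide_eq_decide, and_iff_left_iff_imp]
    rintro rfl
    exact h
  · rw [List.countP_eq_zero]
    rintro ab -
    simp only [decide_eq_true_eq, not_and]
    rintro rfl
    exact h

/-- The integers of absolute value at most `threshold m p d`. -/
noncomputable def window (m : ℕ) (p : ℝ) (d : ℕ) : Finset ℤ :=
  Finset.Icc (-⌊threshold m p d⌋) ⌊threshold m p d⌋

theorem mem_window {m : ℕ} {p : ℝ} {d : ℕ} {x : ℤ} :
    x ∈ window m p d ↔ ((|x| : ℤ) : ℝ) ≤ threshold m p d := by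
  rw [window, Finset.mem_Icc, ← abs_le, Int.le_floor]

theorem mem_window_zero {m : ℕ} {p : ℝ} {x : ℤ} : x ∈ window m p 0 ↔ x ∈ intRange m := by
  have h : ⌊(m : ℝ) / 2⌋ = ((m / 2 : ℕ) : ℤ) := by
    have := Int.floor_div_natCast (m : ℝ) 2
    simpa using this
  rw [window, threshold, h, intRange, Set.mem_Icc, Finset.mem_Icc]

theorem threshold_eq (m : ℕ) (p : ℝ) (d : ℕ) : threshold m p d = p ^ d * m / 2 := by
  induction d with
  | zero => simp [threshold]
  | succ d ih => rw [threshold, ih]; ring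

/-! ### Structure of the level lists and the success criterion -/

section level

variable {t n : ℕ} {m : ℕ} {p : ℝ}

theorem val_mem_window {L : Fin (2 ^ t) → Fin n → ℤ} (hL : ∀ i j, L i j ∈ intRange m)
    (d i : ℕ) (e : Entry n d) (he : e ∈ level m p L d i) : e.val ∈ window m p d := by
  cases d with
  | zero =>
    rw [mem_window_zero]
    rw [level] at he
    split_ifs at he with h
    · obtain ⟨j, rfl⟩ := List.mem_ofFn.1 he
      exact hL _ _
    · simp at he
  | succ d =>
    rw [mem_window]
    simp only [level, merge, List.mem_map, List.mem_filter, decide_eq_true_eq] at he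
    obtain ⟨ab, ⟨-, h⟩, rfl⟩ := he
    exact h

theorem mult_level_succ {L : Fin (2 ^ t) → Fin n → ℤ} (hL : ∀ i j, L i j ∈ intRange m)
    (d i : ℕ) (x : ℤ) :
    mult (level m p L (d + 1) i) x = if x ∈ window m p (d + 1) then
      ∑ y ∈ window m p d,
        mult (level m p L d (2 * i)) y * mult (level m p L d (2 * i + 1)) (x - y) else 0 := by
  simp only [mem_window]
  exact mult_merge _ _ _ (val_mem_window hL d (2 * i)) _ _

theorem mult_level_zero (L : Fin (2 ^ t) → Fin n → ℤ) {i : ℕ} (hi : i < 2 ^ t) (x : ℤ) :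
    mult (level m p L 0 i) x = ∑ j, if L ⟨i, hi⟩ j = x then 1 else 0 := by
  rw [mult, level, dif_pos hi, List.ofFn_eq_map, List.countP_map, List.countP_eq_length_filter,
    ← Finset.card_filter]
  rw [← List.toFinset_card_of_nodup ((List.nodup_finRange n).filter _)]
  congr 1
  ext j
  simp

theorem length_level_le (L : Fin (2 ^ t) → Fin n → ℤ) (d i : ℕ) :
    (level m p L d i).length ≤ n ^ 2 ^ d := by
  induction d generalizing i with
  | zero =>
    rw [level]
    split_ifs <;> simp
  | succ d ih =>
    rw [level, merge, List.length_map]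
    refine (List.length_filter_le _ _).trans ?_
    rw [List.length_product, pow_succ 2 d, mul_two, pow_add]
    exact Nat.mul_le_mul (ih _) (ih _)

theorem length_level_zero (L : Fin (2 ^ t) → Fin n → ℤ) {i : ℕ} (hi : i < 2 ^ t) :
    (level m p L 0 i).length = n := by
  rw [level, dif_pos hi, List.length_ofFn]

/-- Each list is built from a block of `2 ^ d` consecutive input lists. Siblings use disjoint
blocks, which is the source of their independence. -/
theorem level_congr {L L' : Fin (2 ^ t) → Fin n → ℤ} (d i : ℕ)
    (h : ∀ a : Fin (2 ^ t), i * 2 ^ d ≤ a → (a : ℕ) < (i + 1) * 2 ^ d → L a = L' a) :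
    level m p L d i = level m p L' d i := by
  induction d generalizing i with
  | zero =>
    rw [level, level]
    split_ifs with hi
    · rw [h ⟨i, hi⟩ (by simp) (by simp)]
    · rfl
  | succ d ih =>
    rw [level, level, ih (2 * i), ih (2 * i + 1)]
    · intro a h1 h2
      refine h a ?_ ?_ <;> rw [pow_succ] <;> nlinarith
    · intro a h1 h2
      refine h a ?_ ?_ <;> rw [pow_succ] <;> nlinarith

theorem val_eq_sum (L : Fin (2 ^ t) → Fin n → ℤ) (d i : ℕ) (hi : (i + 1) * 2 ^ d ≤ 2 ^ t)
    (e : Entry n d) (he : e ∈ level m p L d i) :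
    e.val = ∑ j : Fin (2 ^ d), L ⟨i * 2 ^ d + j, by have := j.2; nlinarith⟩ (e.idx j) := by
  induction d generalizing i with
  | zero =>
    rw [level] at he
    split_ifs at he with h
    · obtain ⟨j, rfl⟩ := List.mem_ofFn.1 he
      have h0 : ∀ b : Fin (2 ^ 0), (b : ℕ) = 0 := fun b => by simp
      rw [Fintype.sum_eq_single (0 : Fin (2 ^ 0)) fun b hb => absurd (Fin.ext (h0 b)) hb]
      simp
    · simp at he
  | succ d ih =>
    have hl : (2 * i + 1) * 2 ^ d ≤ 2 ^ t := by
      rw [pow_succ] at hi; nlinarith [Nat.zero_le (2 ^ d)]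
    have hr : (2 * i + 1 + 1) * 2 ^ d ≤ 2 ^ t := by rw [pow_succ] at hi; nlinarith
    simp only [level, merge, List.mem_map, List.mem_filter, decide_eq_true_eq] at he
    obtain ⟨⟨a, b⟩, ⟨hab, -⟩, rfl⟩ := he
    replace hab := List.pair_mem_product.1 hab
    have ha := ih (2 * i) hl a hab.1
    have hb := ih (2 * i + 1) hr b hab.2
    have hc : 2 ^ d + 2 ^ d = 2 ^ (d + 1) := by rw [pow_succ, mul_two]
    simp only [Entry.add]
    rw [← (finCongr hc).sum_comp, Fin.sum_univ_add, ha, hb]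
    congr 1
    · refine Finset.sum_congr rfl fun j _ => ?_
      have h1 : (⟨2 * i * 2 ^ d + j, by have := j.2; nlinarith⟩ : Fin (2 ^ t))
        = ⟨i * 2 ^ (d + 1) + (finCongr hc (Fin.castAdd (2 ^ d) j)), by
          have := j.2; simp; rw [pow_succ] at *; nlinarith⟩ := by
        ext; simp; ring
      rw [h1]
      congr 1
      simp
    · refine Finset.sum_congr rfl fun j _ => ?_
      have h1 : (⟨(2 * i + 1) * 2 ^ d + j, by have := j.2; nlinarith⟩ : Fin (2 ^ t))
        = ⟨i * 2 ^ (d + 1) + (finCongr hc (Fin.natAdd (2 ^ d) j)), by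
          have := j.2; simp; rw [pow_succ] at *; nlinarith⟩ := by
        ext; simp; ring
      rw [h1]
      congr 1
      simp [-Fin.natAdd_eq_addNat]

/-- The indices carried by an entry always sum to its value (`val_eq_sum`), so correctness of the
output is automatic and only the presence of a zero matters. -/
theorem succeeds_iff (L : Fin (2 ^ t) → Fin n → ℤ) :
    Succeeds m p L ↔ 0 < mult (level m p L t 0) 0 := by
  rw [mult_pos, Succeeds, ktree]
  constructor
  · rintro ⟨l, hl, -⟩
    obtain ⟨e, he, -⟩ := Option.map_eq_some_iff.1 hl
    exact ⟨e, List.mem_of_find?_eq_some he, by simpa using List.find?_some he⟩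
  · rintro ⟨e, he, h0⟩
    have h1 : ((level m p L t 0).find? fun e => e.val = 0).isSome := by
      rw [List.find?_isSome]
      exact ⟨e, he, by simpa using h0⟩
    obtain ⟨e', he'⟩ := Option.isSome_iff_exists.1 h1
    refine ⟨e'.idx, by rw [he']; rfl, ?_⟩
    have h2 : e'.val = 0 := by simpa using List.find?_some he'
    have h3 := val_eq_sum L t 0 (by simp) e' (List.mem_of_find?_eq_some he')
    rw [h2] at h3
    rw [h3]
    refine Finset.sum_congr rfl fun j _ => ?_
    congr 1
    ext; simp

end level

end KTree

/-! ### Random input: independence and one-step moment formulas -/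

namespace KTree

open MeasureTheory ProbabilityTheory

/-- All entries of the input lists are independent and uniformly distributed on `intRange m`. -/
structure IsUniformInput {Ω : Type*} [MeasurableSpace Ω] (P : Measure Ω) (m : ℕ) {t n : ℕ}
    (L : Fin (2 ^ t) → Fin n → Ω → ℤ) : Prop where
  meas : ∀ i j, Measurable (L i j)
  indep : iIndepFun (fun ij : Fin (2 ^ t) × Fin n => L ij.1 ij.2) P
  unif : ∀ i j, P.map (L i j) = uniformOn (intRange m)

/-- The number of entries with value `x` in the `i`-th list at level `d`, as a random variable. -/
noncomputable def count {Ω : Type*} (m : ℕ) (p : ℝ) {t n : ℕ}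
    (L : Fin (2 ^ t) → Fin n → Ω → ℤ) (d i : ℕ) (x : ℤ) (ω : Ω) : ℝ :=
  mult (level m p (fun a j => L a j ω) d i) x

section

variable {Ω : Type*} {m t n : ℕ} {L : Fin (2 ^ t) → Fin n → Ω → ℤ}

theorem count_nonneg (p : ℝ) (d i : ℕ) (x : ℤ) (ω : Ω) : 0 ≤ count m p L d i x ω :=
  Nat.cast_nonneg _

theorem abs_mult_le (p : ℝ) (d i : ℕ) (x : ℤ) (l : Fin (2 ^ t) → Fin n → ℤ) :
    |(mult (level m p l d i) x : ℝ)| ≤ (n : ℝ) ^ 2 ^ d := by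
  rw [abs_of_nonneg (Nat.cast_nonneg _)]
  exact_mod_cast (mult_le_length _ _).trans (length_level_le l d i)

theorem count_zero (p : ℝ) {i : ℕ} (hi : i < 2 ^ t) (x : ℤ) (ω : Ω) :
    count m p L 0 i x ω = ∑ j, {ω | L ⟨i, hi⟩ j ω = x}.indicator (fun _ => (1 : ℝ)) ω := by
  rw [count, mult_level_zero _ hi]
  simp [Set.indicator_apply]

end

namespace IsUniformInput

variable {Ω : Type*} [MeasurableSpace Ω] {P : Measure Ω} {m t n : ℕ}
  {L : Fin (2 ^ t) → Fin n → Ω → ℤ}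

theorem measurable_comp (h : IsUniformInput P m L) {β : Type*} [MeasurableSpace β]
    (F : (Fin (2 ^ t) → Fin n → ℤ) → β) : Measurable fun ω => F fun a j => L a j ω :=
  (Measurable.of_discrete (f := F)).comp
    (measurable_pi_lambda _ fun a => measurable_pi_lambda _ fun j => h.meas a j)

theorem integrable_comp [IsProbabilityMeasure P] (h : IsUniformInput P m L)
    (F : (Fin (2 ^ t) → Fin n → ℤ) → ℝ) (C : ℝ)
    (hF : ∀ l, |F l| ≤ C) : Integrable (fun ω => F fun a j => L a j ω) P :=
  Integrable.of_bound (h.measurable_comp F).aestronglyMeasurable C (by simp [hF])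

/-- A function that ignores the lists outside `S` factors through the restriction to `S`, with zeros
filled in elsewhere; independence of disjoint families of entries then applies. -/
theorem indepFun_comp (h : IsUniformInput P m L) {S T : Finset (Fin (2 ^ t))} (hST : Disjoint S T)
    {F G : (Fin (2 ^ t) → Fin n → ℤ) → ℝ}
    (hF : ∀ l l', (∀ a ∈ S, l a = l' a) → F l = F l')
    (hG : ∀ l l', (∀ a ∈ T, l a = l' a) → G l = G l') :
    IndepFun (fun ω => F fun a j => L a j ω) (fun ω => G fun a j => L a j ω) P := by
  have h1 := h.indep.indepFun_finset (S ×ˢ Finset.univ) (T ×ˢ Finset.univ)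
    (Finset.disjoint_product.2 (Or.inl hST)) fun ij => h.meas ij.1 ij.2
  have ext (U : Finset (Fin (2 ^ t))) {H : (Fin (2 ^ t) → Fin n → ℤ) → ℝ}
      (hH : ∀ l l', (∀ a ∈ U, l a = l' a) → H l = H l') :
      (fun ω => H fun a j => L a j ω)
        = (fun g : (↥(U ×ˢ (Finset.univ : Finset (Fin n))) → ℤ) => H fun a j =>
          if ha : (a, j) ∈ U ×ˢ (Finset.univ : Finset (Fin n)) then g ⟨(a, j), ha⟩ else 0)
          ∘ fun ω ij => L ij.1.1 ij.1.2 ω := by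
    funext ω
    refine hH _ _ fun a ha => ?_
    funext j
    simp [ha]
  rw [ext S hF, ext T hG]
  exact h1.comp Measurable.of_discrete Measurable.of_discrete

theorem ae_mem (h : IsUniformInput P m L) : ∀ᵐ ω ∂P, ∀ i j, L i j ω ∈ intRange m := by
  rw [ae_all_iff]
  intro i
  rw [ae_all_iff]
  intro j
  have h1 : ∀ᵐ x ∂(P.map (L i j)), x ∈ intRange m := by
    rw [h.unif]
    exact ae_cond_mem (Set.to_countable _).measurableSet
  exact ae_of_ae_map (h.meas i j).aemeasurable h1

theorem measureReal_eq (h : IsUniformInput P m L) (p : ℝ) (i : Fin (2 ^ t)) (j : Fin n) (x : ℤ) :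
    P.real {ω | L i j ω = x}
      = if x ∈ window m p 0 then 1 / ((window m p 0).card : ℝ) else 0 := by
  have h1 : P.real {ω | L i j ω = x} = (P.map (L i j)).real {x} := by
    rw [map_measureReal_apply (h.meas i j) (measurableSet_singleton x)]
    rfl
  have h2 : intRange m = (window m p 0 : Set ℤ) := by
    ext y
    rw [← mem_window_zero (p := p)]
    rfl
  rw [h1, h.unif, h2, Measure.real, ← Finset.coe_singleton, uniformOn_apply_finset]
  split_ifs with hx
  · rw [Finset.inter_singleton_of_mem hx]
    simp
  · rw [Finset.inter_singleton_of_notMem hx]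
    simp

theorem integrable_count [IsProbabilityMeasure P] (h : IsUniformInput P m L)
    (p : ℝ) (d i : ℕ) (x : ℤ) :
    Integrable (count m p L d i x) P :=
  h.integrable_comp (fun l => (mult (level m p l d i) x : ℝ)) _ (abs_mult_le p d i x)

theorem integrable_count_mul [IsProbabilityMeasure P] (h : IsUniformInput P m L)
    (p : ℝ) (d i d' i' : ℕ) (x y : ℤ) :
    Integrable (fun ω => count m p L d i x ω * count m p L d' i' y ω) P :=
  h.integrable_comp
    (fun l => (mult (level m p l d i) x : ℝ) * (mult (level m p l d' i') y : ℝ))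
    ((n : ℝ) ^ 2 ^ d * (n : ℝ) ^ 2 ^ d') fun l => by
      rw [abs_mul]
      exact mul_le_mul (abs_mult_le p d i x l) (abs_mult_le p d' i' y l) (abs_nonneg _)
        (by positivity)

/-- Functions of sibling lists are independent. -/
theorem integral_sibling_mul (h : IsUniformInput P m L) (p : ℝ) (d i : ℕ)
    (f g : List (Entry n d) → ℝ) :
    ∫ ω, f (level m p (fun a j => L a j ω) d (2 * i))
        * g (level m p (fun a j => L a j ω) d (2 * i + 1)) ∂P
      = (∫ ω, f (level m p (fun a j => L a j ω) d (2 * i)) ∂P)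
        * ∫ ω, g (level m p (fun a j => L a j ω) d (2 * i + 1)) ∂P := by
  have block (b : ℕ) (f : List (Entry n d) → ℝ) (l l' : Fin (2 ^ t) → Fin n → ℤ)
      (hl : ∀ a ∈ Finset.univ.filter fun a : Fin (2 ^ t) =>
        b * 2 ^ d ≤ (a : ℕ) ∧ (a : ℕ) < (b + 1) * 2 ^ d, l a = l' a) :
      f (level m p l d b) = f (level m p l' d b) := by
    rw [level_congr d b fun a h1 h2 => hl a (by simp [h1, h2])]
  refine IndepFun.integral_fun_mul_eq_mul_integral
    (h.indepFun_comp ?_ (block (2 * i) f) (block (2 * i + 1) g))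
    (h.measurable_comp fun l => f (level m p l d (2 * i))).aestronglyMeasurable
    (h.measurable_comp fun l => g (level m p l d (2 * i + 1))).aestronglyMeasurable
  rw [Finset.disjoint_left]
  intro a h1 h2
  simp only [Finset.mem_filter, Finset.mem_univ, true_and] at h1 h2
  omega

theorem count_succ_ae (h : IsUniformInput P m L) (p : ℝ) (d i : ℕ) :
    ∀ᵐ ω ∂P, ∀ x, count m p L (d + 1) i x ω = if x ∈ window m p (d + 1) then
      ∑ y ∈ window m p d, count m p L d (2 * i) y ω * count m p L d (2 * i + 1) (x - y) ω
      else 0 := by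
  filter_upwards [h.ae_mem] with ω hω x
  rw [count, mult_level_succ hω]
  split_ifs
  · push_cast
    rfl
  · simp

theorem count_eq_zero_ae (h : IsUniformInput P m L) (p : ℝ) (d i : ℕ) :
    ∀ᵐ ω ∂P, ∀ x ∉ window m p d, count m p L d i x ω = 0 := by
  filter_upwards [h.ae_mem] with ω hω x hx
  rw [count, Nat.cast_eq_zero, mult_eq_zero]
  rintro e he rfl
  exact hx (val_mem_window hω d i e he)

theorem integral_count_of_notMem (h : IsUniformInput P m L) (p : ℝ) (d i : ℕ) {x : ℤ}
    (hx : x ∉ window m p d) : ∫ ω, count m p L d i x ω ∂P = 0 := by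
  refine integral_eq_zero_of_ae ?_
  filter_upwards [h.count_eq_zero_ae p d i] with ω hω
  exact hω x hx

theorem integral_count_succ [IsProbabilityMeasure P] (h : IsUniformInput P m L)
    (p : ℝ) (d i : ℕ) {x : ℤ}
    (hx : x ∈ window m p (d + 1)) :
    ∫ ω, count m p L (d + 1) i x ω ∂P = ∑ y ∈ window m p d,
      (∫ ω, count m p L d (2 * i) y ω ∂P) * ∫ ω, count m p L d (2 * i + 1) (x - y) ω ∂P := by
  have h1 : ∫ ω, count m p L (d + 1) i x ω ∂P = ∫ ω, ∑ y ∈ window m p d,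
      count m p L d (2 * i) y ω * count m p L d (2 * i + 1) (x - y) ω ∂P := by
    refine integral_congr_ae ?_
    filter_upwards [h.count_succ_ae p d i] with ω hω
    rw [hω x, if_pos hx]
  rw [h1, integral_finsetSum _ fun y _ => h.integrable_count_mul p d _ d _ _ _]
  exact Finset.sum_congr rfl fun y _ => h.integral_sibling_mul p d i
    (fun l => (mult l y : ℝ)) (fun l => (mult l (x - y) : ℝ))

theorem integral_count_mul_succ [IsProbabilityMeasure P] (h : IsUniformInput P m L)
    (p : ℝ) (d i : ℕ) {x y : ℤ}
    (hx : x ∈ window m p (d + 1)) (hy : y ∈ window m p (d + 1)) :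
    ∫ ω, count m p L (d + 1) i x ω * count m p L (d + 1) i y ω ∂P
      = ∑ a ∈ window m p d, ∑ b ∈ window m p d,
        (∫ ω, count m p L d (2 * i) a ω * count m p L d (2 * i) b ω ∂P)
        * ∫ ω, count m p L d (2 * i + 1) (x - a) ω * count m p L d (2 * i + 1) (y - b) ω ∂P := by
  have h1 : ∫ ω, count m p L (d + 1) i x ω * count m p L (d + 1) i y ω ∂P
      = ∫ ω, ∑ a ∈ window m p d, ∑ b ∈ window m p d,
        (count m p L d (2 * i) a ω * count m p L d (2 * i) b ω)
          * (count m p L d (2 * i + 1) (x - a) ω * count m p L d (2 * i + 1) (y - b) ω) ∂P := by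
    refine integral_congr_ae ?_
    filter_upwards [h.count_succ_ae p d i] with ω hω
    rw [hω x, hω y, if_pos hx, if_pos hy, Finset.sum_mul_sum]
    exact Finset.sum_congr rfl fun a _ => Finset.sum_congr rfl fun b _ => by ring
  have hint : ∀ a b, Integrable (fun ω =>
      (count m p L d (2 * i) a ω * count m p L d (2 * i) b ω)
          * (count m p L d (2 * i + 1) (x - a) ω * count m p L d (2 * i + 1) (y - b) ω)) P := by
    intro a b
    refine h.integrable_comp (fun l => ((mult (level m p l d (2 * i)) a : ℝ)
      * (mult (level m p l d (2 * i)) b : ℝ)) * ((mult (level m p l d (2 * i + 1)) (x - a) : ℝ)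
      * (mult (level m p l d (2 * i + 1)) (y - b) : ℝ)))
      (((n : ℝ) ^ 2 ^ d * (n : ℝ) ^ 2 ^ d) * ((n : ℝ) ^ 2 ^ d * (n : ℝ) ^ 2 ^ d)) fun l => ?_
    rw [abs_mul, abs_mul, abs_mul]
    gcongr <;> exact abs_mult_le _ _ _ _ _
  rw [h1, integral_finsetSum _ fun a _ => integrable_finsetSum _ fun b _ => hint a b]
  refine Finset.sum_congr rfl fun a _ => ?_
  rw [integral_finsetSum _ fun b _ => hint a b]
  exact Finset.sum_congr rfl fun b _ => h.integral_sibling_mul p d i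
    (fun l => (mult l a : ℝ) * (mult l b : ℝ))
    (fun l => (mult l (x - a) : ℝ) * (mult l (y - b) : ℝ))

theorem measurableSet_eq (h : IsUniformInput P m L) (i : Fin (2 ^ t)) (j : Fin n) (x : ℤ) :
    MeasurableSet {ω | L i j ω = x} :=
  h.meas i j (measurableSet_singleton x)

theorem integral_count_zero [IsProbabilityMeasure P] (h : IsUniformInput P m L)
    (p : ℝ) {i : ℕ} (hi : i < 2 ^ t) (x : ℤ) :
    ∫ ω, count m p L 0 i x ω ∂P
      = if x ∈ window m p 0 then n / ((window m p 0).card : ℝ) else 0 := by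
  simp_rw [count_zero p hi]
  rw [integral_finsetSum _ fun j _ =>
    (integrable_const (1 : ℝ)).indicator (h.measurableSet_eq _ j x)]
  simp_rw [integral_indicator_const (1 : ℝ) (h.measurableSet_eq ⟨i, hi⟩ _ x), smul_eq_mul,
    mul_one, h.measureReal_eq p]
  split_ifs
  · simp [div_eq_mul_inv]
  · simp

theorem integral_count_mul_zero_le [IsProbabilityMeasure P] (h : IsUniformInput P m L)
    (p : ℝ) {i : ℕ} (hi : i < 2 ^ t)
    (x y : ℤ) :
    ∫ ω, count m p L 0 i x ω * count m p L 0 i y ω ∂P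
      ≤ (n / ((window m p 0).card : ℝ)) ^ 2
        + if x = y then ∫ ω, count m p L 0 i x ω ∂P else 0 := by
  set N : ℝ := ((window m p 0).card : ℝ)
  have hms := h.measurableSet_eq ⟨i, hi⟩
  have hpair : ∀ ω, count m p L 0 i x ω * count m p L 0 i y ω = ∑ j, ∑ j',
      ({ω | L ⟨i, hi⟩ j ω = x} ∩ {ω | L ⟨i, hi⟩ j' ω = y}).indicator (fun _ => (1 : ℝ)) ω := by
    intro ω
    rw [count_zero p hi, count_zero p hi, Finset.sum_mul_sum]
    refine Finset.sum_congr rfl fun j _ => Finset.sum_congr rfl fun j' _ => ?_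
    simp only [Set.indicator_apply, Set.mem_inter_iff, Set.mem_ofPred_eq]
    split_ifs <;> simp_all
  have hle : ∀ j y, P.real {ω | L ⟨i, hi⟩ j ω = y} ≤ 1 / N := by
    intro j y
    rw [h.measureReal_eq p]
    split_ifs
    · rfl
    · positivity
  -- Distinct positions are independent. A position paired with itself is also charged `(1 / N) ^
  -- 2`, an overcount that makes these charges sum to exactly `(n / N) ^ 2`.
  have hprob : ∀ j j', P.real ({ω | L ⟨i, hi⟩ j ω = x} ∩ {ω | L ⟨i, hi⟩ j' ω = y})
      ≤ (1 / N) ^ 2 + if j = j' then (if x = y then P.real {ω | L ⟨i, hi⟩ j ω = x} else 0)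
        else 0 := by
    intro j j'
    by_cases hj : j = j'
    · subst hj
      rw [if_pos rfl]
      split_ifs with hxy
      · subst hxy
        rw [Set.inter_self]
        linarith [sq_nonneg (1 / N)]
      · have : {ω | L ⟨i, hi⟩ j ω = x} ∩ {ω | L ⟨i, hi⟩ j ω = y} = ∅ := by
          ext ω
          simp only [Set.mem_inter_iff, Set.mem_ofPred_eq, Set.mem_empty_iff_false, iff_false]
          rintro ⟨rfl, h2⟩
          exact hxy h2
        rw [this]
        simp
        positivity
    · rw [if_neg hj, add_zero]
      have hi2 : IndepFun (L ⟨i, hi⟩ j) (L ⟨i, hi⟩ j') P :=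
        h.indep.indepFun (i := (⟨i, hi⟩, j)) (j := (⟨i, hi⟩, j')) (by simp [hj])
      have h3 := hi2.measure_inter_preimage_eq_mul {x} {y} (measurableSet_singleton x)
        (measurableSet_singleton y)
      rw [sq]
      refine ((congrArg ENNReal.toReal h3).trans ENNReal.toReal_mul).trans_le ?_
      exact mul_le_mul (hle j x) (hle j' y) measureReal_nonneg (by positivity)
  have hint : ∀ j j', Integrable (({ω | L ⟨i, hi⟩ j ω = x} ∩ {ω | L ⟨i, hi⟩ j' ω = y}).indicator
      (fun _ => (1 : ℝ))) P := fun j j' =>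
    (integrable_const (1 : ℝ)).indicator ((hms j x).inter (hms j' y))
  simp_rw [hpair]
  rw [integral_finsetSum _ fun j _ => integrable_finsetSum _ fun j' _ => hint j j']
  have h4 : ∀ j, ∫ ω, ∑ j', ({ω | L ⟨i, hi⟩ j ω = x} ∩ {ω | L ⟨i, hi⟩ j' ω = y}).indicator
      (fun _ => (1 : ℝ)) ω ∂P
      ≤ n * (1 / N) ^ 2 + if x = y then P.real {ω | L ⟨i, hi⟩ j ω = x} else 0 := by
    intro j
    rw [integral_finsetSum _ fun j' _ => hint j j']
    simp_rw [integral_indicator_const (1 : ℝ) ((hms _ x).inter (hms _ y)), smul_eq_mul, mul_one]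
    refine (Finset.sum_le_sum fun j' _ => hprob j j').trans ?_
    rw [Finset.sum_add_distrib]
    simp
  refine (Finset.sum_le_sum fun j _ => h4 j).trans ?_
  rw [Finset.sum_add_distrib]
  have h5 : ∫ ω, count m p L 0 i x ω ∂P = ∑ j, P.real {ω | L ⟨i, hi⟩ j ω = x} := by
    simp_rw [count_zero p hi]
    rw [integral_finsetSum _ fun j _ => (integrable_const (1 : ℝ)).indicator (hms j x)]
    simp_rw [integral_indicator_const (1 : ℝ) (hms _ x), smul_eq_mul, mul_one]
  rw [h5]
  refine add_le_add (le_of_eq ?_) (le_of_eq ?_)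
  · simp
    ring
  · split_ifs <;> simp

end IsUniformInput

end KTree

/-! ### Moment bounds by induction over the tree -/

namespace KTree

open MeasureTheory ProbabilityTheory

namespace IsUniformInput

variable {Ω : Type*} [MeasurableSpace Ω] {P : Measure Ω} {m t n : ℕ}
  {L : Fin (2 ^ t) → Fin n → Ω → ℤ}

/-- Induction over the nodes of the binary tree of lists. -/
theorem node_induction {t : ℕ} {C : ℕ → ℕ → Prop} (h0 : ∀ i < 2 ^ t, C 0 i)
    (hs : ∀ d i, d < t → (i + 1) * 2 ^ (d + 1) ≤ 2 ^ t →
      C d (2 * i) → C d (2 * i + 1) → C (d + 1) i) :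
    ∀ d i, (i + 1) * 2 ^ d ≤ 2 ^ t → C d i := by
  intro d
  induction d with
  | zero => exact fun i hi => h0 i (by simpa using hi)
  | succ d ih =>
    intro i hi
    have hd : d < t := by
      have h1 : 2 ^ (d + 1) ≤ 2 ^ t := le_trans (Nat.le_mul_of_pos_left _ i.succ_pos) hi
      exact (Nat.pow_le_pow_iff_right Nat.one_lt_two).1 h1
    refine hs d i hd hi ?_ ?_ <;> rw [pow_succ] at hi
    · exact ih _ (by nlinarith [Nat.zero_le (2 ^ d)])
    · exact ih _ (by nlinarith)

theorem integral_count_nonneg (P : Measure Ω) (L : Fin (2 ^ t) → Fin n → Ω → ℤ) (p : ℝ)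
    (d i : ℕ) (x : ℤ) : 0 ≤ ∫ ω, count m p L d i x ω ∂P :=
  integral_nonneg fun ω => count_nonneg p d i x ω

theorem integral_count_le [IsProbabilityMeasure P] (h : IsUniformInput P m L) (p : ℝ) {δ M : ℕ → ℝ}
    (hM : ∀ d < t, ((window m p d).card : ℝ) ≤ M d) (hδ : ∀ d, 0 ≤ δ d)
    (hδ0 : n / ((window m p 0).card : ℝ) ≤ δ 0) (hδs : ∀ d < t, δ d ^ 2 * M d ≤ δ (d + 1)) :
    ∀ d i, (i + 1) * 2 ^ d ≤ 2 ^ t → ∀ x, ∫ ω, count m p L d i x ω ∂P ≤ δ d := by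
  refine node_induction ?_ ?_
  · intro i hi x
    rw [h.integral_count_zero p hi]
    split_ifs
    · exact hδ0
    · exact hδ 0
  · intro d i hd _ hl hr x
    by_cases hx : x ∈ window m p (d + 1)
    · rw [h.integral_count_succ p d i hx]
      calc _ ≤ ∑ y ∈ window m p d, δ d * δ d := Finset.sum_le_sum fun y _ =>
            mul_le_mul (hl y) (hr _) (integral_count_nonneg P L p _ _ _) (hδ d)
        _ = δ d ^ 2 * (window m p d).card := by simp; ring
        _ ≤ δ d ^ 2 * M d := mul_le_mul_of_nonneg_left (hM d hd) (sq_nonneg _)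
        _ ≤ _ := hδs d hd
    · rw [h.integral_count_of_notMem p _ _ hx]
      exact hδ _

/-- Only summands with both `y` and `x - y` in the window come with a lower bound; `K d` bounds
their number from below, and the rest are dropped. -/
theorem le_integral_count [IsProbabilityMeasure P] (h : IsUniformInput P m L)
    (p : ℝ) {l K : ℕ → ℝ} (hl : ∀ d, 0 ≤ l d)
    (hK : ∀ d < t, ∀ x ∈ window m p (d + 1),
      K d ≤ (((window m p d).filter fun y => x - y ∈ window m p d).card : ℝ))
    (hl0 : l 0 ≤ n / ((window m p 0).card : ℝ)) (hls : ∀ d < t, l (d + 1) ≤ l d ^ 2 * K d) :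
    ∀ d i, (i + 1) * 2 ^ d ≤ 2 ^ t →
      ∀ x ∈ window m p d, l d ≤ ∫ ω, count m p L d i x ω ∂P := by
  refine node_induction ?_ ?_
  · intro i hi x hx
    rw [h.integral_count_zero p hi, if_pos hx]
    exact hl0
  · intro d i hd _ hle hri x hx
    rw [h.integral_count_succ p d i hx]
    calc l (d + 1) ≤ l d ^ 2 * K d := hls d hd
      _ ≤ l d ^ 2 * ((window m p d).filter fun y => x - y ∈ window m p d).card :=
        mul_le_mul_of_nonneg_left (hK d hd x hx) (sq_nonneg _)
      _ = ∑ y ∈ (window m p d).filter fun y => x - y ∈ window m p d, l d * l d := by simp; ring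
      _ ≤ ∑ y ∈ (window m p d).filter fun y => x - y ∈ window m p d,
          (∫ ω, count m p L d (2 * i) y ω ∂P)
            * ∫ ω, count m p L d (2 * i + 1) (x - y) ω ∂P := by
        refine Finset.sum_le_sum fun y hy => ?_
        rw [Finset.mem_filter] at hy
        exact mul_le_mul (hle y hy.1) (hri _ hy.2) (hl d) (integral_count_nonneg P L p _ _ _)
      _ ≤ _ := Finset.sum_le_sum_of_subset_of_nonneg (Finset.filter_subset _ _) fun y _ _ =>
        mul_nonneg (integral_count_nonneg P L p _ _ _) (integral_count_nonneg P L p _ _ _)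

theorem integral_count_mul_le [IsProbabilityMeasure P] (h : IsUniformInput P m L)
    (p : ℝ) {δ M α : ℕ → ℝ}
    (hM : ∀ d < t, ((window m p d).card : ℝ) ≤ M d) (hδ : ∀ d, 0 ≤ δ d)
    (hδ0 : n / ((window m p 0).card : ℝ) ≤ δ 0) (hδs : ∀ d < t, δ d ^ 2 * M d ≤ δ (d + 1))
    (hα : ∀ d, 0 ≤ α d) (hα0 : (n / ((window m p 0).card : ℝ)) ^ 2 ≤ α 0)
    (hαs : ∀ d < t, α d ^ 2 * M d ^ 2 + 2 * (α d * δ d * M d) ≤ α (d + 1)) :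
    ∀ d i, (i + 1) * 2 ^ d ≤ 2 ^ t → ∀ x y,
      ∫ ω, count m p L d i x ω * count m p L d i y ω ∂P
        ≤ α d + if x = y then ∫ ω, count m p L d i x ω ∂P else 0 := by
  have hfirst := h.integral_count_le p hM hδ hδ0 hδs
  refine node_induction ?_ ?_
  · intro i hi x y
    refine (h.integral_count_mul_zero_le p hi x y).trans ?_
    gcongr
  · intro d i hd hb hl hr x y
    rw [pow_succ] at hb
    have hbl : (2 * i + 1) * 2 ^ d ≤ 2 ^ t := by nlinarith [Nat.zero_le (2 ^ d)]
    have hbr : (2 * i + 1 + 1) * 2 ^ d ≤ 2 ^ t := by nlinarith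
    have hzero : ∀ z, z ∉ window m p (d + 1) → (z = x ∨ z = y) →
        ∫ ω, count m p L (d + 1) i x ω * count m p L (d + 1) i y ω ∂P = 0 := by
      intro z hz hxy
      refine integral_eq_zero_of_ae ?_
      filter_upwards [h.count_eq_zero_ae p (d + 1) i] with ω hω
      rcases hxy with rfl | rfl <;> simp [hω _ hz]
    have hnn : 0 ≤ α (d + 1) + if x = y then ∫ ω, count m p L (d + 1) i x ω ∂P else 0 := by
      refine add_nonneg (hα _) ?_
      split_ifs
      · exact integral_count_nonneg P L p _ _ _
      · exact le_rfl
    by_cases hx : x ∈ window m p (d + 1)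
    swap
    · rw [hzero x hx (Or.inl rfl)]; exact hnn
    by_cases hy : y ∈ window m p (d + 1)
    swap
    · rw [hzero y hy (Or.inr rfl)]; exact hnn
    rw [h.integral_count_mul_succ p d i hx hy, h.integral_count_succ p d i hx]
    set J := window m p d
    set D : ℤ → ℝ := fun a => ∫ ω, count m p L d (2 * i) a ω ∂P
    set D' : ℤ → ℝ := fun a => ∫ ω, count m p L d (2 * i + 1) a ω ∂P
    have hD : ∀ a, 0 ≤ D a := fun a => integral_count_nonneg P L p _ _ _
    have hD' : ∀ a, 0 ≤ D' a := fun a => integral_count_nonneg P L p _ _ _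
    have hDδ : ∀ a, D a ≤ δ d := hfirst d _ hbl
    have hDδ' : ∀ a, D' a ≤ δ d := hfirst d _ hbr
    -- Of the four products of an `α` part and a diagonal part, the mixed ones are bounded through
    -- `δ d`. The product of both diagonals forces `a = b` and `x = y`, and is kept exact.
    have hterm : ∀ a b, (∫ ω, count m p L d (2 * i) a ω * count m p L d (2 * i) b ω ∂P)
          * ∫ ω, count m p L d (2 * i + 1) (x - a) ω * count m p L d (2 * i + 1) (y - b) ω ∂P
        ≤ α d ^ 2 + (if y - x + a = b then α d * δ d else 0) + (if a = b then α d * δ d else 0)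
          + if a = b then (if x = y then D a * D' (x - a) else 0) else 0 := by
      intro a b
      refine (mul_le_mul (hl a b) (hr _ _)
        (integral_nonneg fun ω => mul_nonneg (count_nonneg ..) (count_nonneg ..)) ?_).trans ?_
      · refine add_nonneg (hα _) ?_
        split_ifs
        · exact hD a
        · exact le_rfl
      have e1 : (x - a = y - b) ↔ (y - x + a = b) := by constructor <;> intro _ <;> omega
      simp only [e1]
      have k1 := mul_le_mul_of_nonneg_left (hDδ a) (hα d)
      have k2 := mul_le_mul_of_nonneg_left (hDδ' (x - a)) (hα d)
      change (α d + if a = b then D a else 0)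
        * (α d + if y - x + a = b then D' (x - a) else 0) ≤ _
      by_cases c1 : y - x + a = b <;> by_cases c2 : a = b
      · have c3 : x = y := by omega
        simp only [if_pos c1, if_pos c2, if_pos c3]
        nlinarith
      · simp only [if_pos c1, if_neg c2]
        nlinarith
      · have c3 : ¬ x = y := by omega
        simp only [if_neg c1, if_pos c2, if_neg c3]
        nlinarith
      · simp only [if_neg c1, if_neg c2]
        nlinarith
    have hαδ : 0 ≤ α d * δ d := mul_nonneg (hα d) (hδ d)
    have hrow : ∀ a ∈ J, ∑ b ∈ J,
          (∫ ω, count m p L d (2 * i) a ω * count m p L d (2 * i) b ω ∂P)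
          * ∫ ω, count m p L d (2 * i + 1) (x - a) ω * count m p L d (2 * i + 1) (y - b) ω ∂P
        ≤ J.card * α d ^ 2 + 2 * (α d * δ d) + if x = y then D a * D' (x - a) else 0 := by
      intro a ha
      refine (Finset.sum_le_sum fun b _ => hterm a b).trans ?_
      simp only [Finset.sum_add_distrib, Finset.sum_ite_eq, if_pos ha, Finset.sum_const,
        nsmul_eq_mul]
      have : (if y - x + a ∈ J then α d * δ d else 0) ≤ α d * δ d := by
        split_ifs
        · exact le_rfl
        · exact hαδ
      linarith
    refine (Finset.sum_le_sum hrow).trans ?_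
    rw [Finset.sum_add_distrib]
    refine add_le_add ?_ (le_of_eq ?_)
    · have hJ := hM d hd
      have hJ0 : (0 : ℝ) ≤ J.card := Nat.cast_nonneg _
      rw [Finset.sum_const, nsmul_eq_mul]
      refine le_trans ?_ (hαs d hd)
      calc (J.card : ℝ) * (J.card * α d ^ 2 + 2 * (α d * δ d))
          = α d ^ 2 * (J.card : ℝ) ^ 2 + 2 * (α d * δ d * J.card) := by ring
        _ ≤ _ := by gcongr
    -- The exact diagonal products add up to the convolution formula for the first moment, so the
    -- diagonal term passes to the parent without loss.
    · split_ifs <;> simp [D, D']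

theorem length_ae (h : IsUniformInput P m L) (p : ℝ) (d i : ℕ) :
    ∀ᵐ ω ∂P, ((level m p (fun a j => L a j ω) d i).length : ℝ)
      = ∑ x ∈ window m p d, count m p L d i x ω := by
  filter_upwards [h.ae_mem] with ω hω
  rw [← sum_mult _ _ (val_mem_window hω d i)]
  push_cast
  rfl

theorem integral_length [IsProbabilityMeasure P] (h : IsUniformInput P m L) (p : ℝ) (d i : ℕ) :
    ∫ ω, ((level m p (fun a j => L a j ω) d i).length : ℝ) ∂P
      = ∑ x ∈ window m p d, ∫ ω, count m p L d i x ω ∂P := by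
  rw [integral_congr_ae (h.length_ae p d i),
    integral_finsetSum _ fun x _ => h.integrable_count p d i x]

theorem integrable_length [IsProbabilityMeasure P] (h : IsUniformInput P m L) (p : ℝ) (d i : ℕ) :
    Integrable (fun ω => ((level m p (fun a j => L a j ω) d i).length : ℝ)) P :=
  h.integrable_comp (fun l => ((level m p l d i).length : ℝ)) ((n : ℝ) ^ 2 ^ d) fun l => by
    rw [abs_of_nonneg (Nat.cast_nonneg _)]
    exact_mod_cast length_level_le l d i

/-- The second moment method. -/
theorem second_moment_le [IsProbabilityMeasure P] (h : IsUniformInput P m L)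
    (p : ℝ) {l U : ℝ} (hl : 0 ≤ l) (hU : 0 < U)
    (h1 : l ≤ ∫ ω, count m p L t 0 0 ω ∂P)
    (h2 : ∫ ω, count m p L t 0 0 ω * count m p L t 0 0 ω ∂P ≤ U) :
    l ^ 2 / U ≤ P.real {ω | Succeeds m p fun i j => L i j ω} := by
  set X := count m p L t 0 0
  set A := {ω | Succeeds m p fun i j => L i j ω}
  have hA : MeasurableSet A := by
    have := h.measurable_comp fun l => Succeeds m p l
    exact measurableSet_setOfPred.2 this
  -- This `s` maximises `2 * s * l - s ^ 2 * U`, with maximum `l ^ 2 / U`. The integrand below is `1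
  -- - (1 - s * X) ^ 2`, which is at most the indicator of `X ≠ 0`.
  set s := l / U
  have hs : 0 ≤ s := by positivity
  have hX : Integrable X P := h.integrable_count p t 0 0
  have hXX : Integrable (fun ω => X ω * X ω) P := h.integrable_count_mul p t 0 t 0 0 0
  have h3 : ∫ ω, (2 * s * X ω - s ^ 2 * (X ω * X ω)) ∂P ≤ ∫ ω, A.indicator (fun _ => 1) ω ∂P := by
    refine integral_mono ((hX.const_mul _).sub (hXX.const_mul _))
      ((integrable_const _).indicator hA) fun ω => ?_
    by_cases hω : ω ∈ A
    · rw [Set.indicator_of_mem hω]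
      nlinarith [sq_nonneg (1 - s * X ω)]
    · rw [Set.indicator_of_notMem hω]
      have : X ω = 0 := by
        have h4 : ¬ Succeeds m p fun i j => L i j ω := hω
        rw [succeeds_iff, not_lt, Nat.le_zero] at h4
        simp only [X, count, h4, Nat.cast_zero]
      simp [this]
  rw [integral_indicator_const (1 : ℝ) hA, smul_eq_mul, mul_one,
    integral_sub (hX.const_mul _) (hXX.const_mul _), integral_const_mul, integral_const_mul] at h3
  refine le_trans ?_ h3
  have h5 : l ^ 2 / U = 2 * s * l - s ^ 2 * U := by
    simp only [s]; field_simp; ring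
  rw [h5]
  gcongr

/-- The first moment method. -/
theorem le_first_moment [IsProbabilityMeasure P] (h : IsUniformInput P m L) (p : ℝ) :
    P.real {ω | Succeeds m p fun i j => L i j ω} ≤ ∫ ω, count m p L t 0 0 ω ∂P := by
  have hA : MeasurableSet {ω | Succeeds m p fun i j => L i j ω} :=
    measurableSet_setOfPred.2 (h.measurable_comp fun l => Succeeds m p l)
  have h3 := integral_indicator_const (μ := P) (1 : ℝ) hA
  rw [smul_eq_mul, mul_one] at h3
  rw [← h3]
  refine integral_mono ((integrable_const _).indicator hA) (h.integrable_count p t 0 0)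
    fun ω => ?_
  refine Set.indicator_apply_le' (fun hω => ?_) fun _ => count_nonneg ..
  have h4 : 0 < mult (level m p (fun a j => L a j ω) t 0) 0 := (succeeds_iff _).1 hω
  exact Nat.one_le_cast.2 h4

end IsUniformInput

end KTree

/-! ### Window sizes and densities for the chosen parameters -/

namespace KTree

open MeasureTheory ProbabilityTheory

/-- The parameters of the `k`-Tree algorithm with `k = 2 ^ t`. -/
structure IsParam (t m : ℕ) (p : ℝ) : Prop where
  m_pos : 0 < m
  p_pos : 0 < p
  p_lt : 30 * p < 1
  pow_mul : p ^ (t + 1) * m = 1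

theorem isParam_rpow {t m : ℕ} (hm : 30 ^ (t + 1) < m) :
    IsParam t m ((m : ℝ) ^ (-1 / ((t : ℝ) + 1))) := by
  have hm0 : 0 < m := (Nat.zero_le _).trans_lt hm
  have hmR : (0 : ℝ) < m := Nat.cast_pos.2 hm0
  set p := (m : ℝ) ^ (-1 / ((t : ℝ) + 1))
  have hp : 0 < p := Real.rpow_pos_of_pos hmR _
  have h1 : p ^ (t + 1) * m = 1 := by
    rw [← Real.rpow_natCast p, ← Real.rpow_mul hmR.le]
    have : -1 / ((t : ℝ) + 1) * ((t + 1 : ℕ) : ℝ) = -1 := by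
      push_cast
      field_simp
    rw [this, Real.rpow_neg_one, inv_mul_cancel₀ hmR.ne']
  refine ⟨hm0, hp, ?_, h1⟩
  by_contra hcon
  have h2 : 1 ≤ (30 * p) ^ (t + 1) := one_le_pow₀ (not_lt.1 hcon)
  have h3 : (30 : ℝ) ^ (t + 1) < m := by exact_mod_cast hm
  rw [mul_pow] at h2
  have h4 : 0 < p ^ (t + 1) := by positivity
  nlinarith

namespace IsParam

variable {t m : ℕ} {p : ℝ}

/-- Up to level `t` the windows have width at least `1 / p`, so a rounding error of one integer is a
relative error of at most `p`. -/
theorem one_le (h : IsParam t m p) {d : ℕ} (hd : d ≤ t) : 1 ≤ p ^ d * m * p := by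
  have hp := h.p_pos
  have hp1 : p ≤ 1 := by linarith [h.p_lt]
  have h1 : p ^ (t + 1) ≤ p ^ (d + 1) := pow_le_pow_of_le_one hp.le hp1 (by omega)
  have h2 := mul_le_mul_of_nonneg_right h1 (Nat.cast_nonneg (α := ℝ) m)
  rw [h.pow_mul, pow_succ] at h2
  linarith

theorem card_window (h : IsParam t m p) (d : ℕ) :
    ((window m p d).card : ℝ) = 2 * ⌊p ^ d * m / 2⌋ + 1 := by
  have hp := h.p_pos
  have h0 : 0 ≤ ⌊p ^ d * m / 2⌋ := Int.floor_nonneg.2 (by positivity)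
  rw [window, Int.card_Icc, threshold_eq]
  set F := ⌊p ^ d * m / 2⌋
  have h1 : ((F + 1 - -F).toNat : ℤ) = 2 * F + 1 := by omega
  exact_mod_cast h1

theorem card_window_le (h : IsParam t m p) {d : ℕ} (hd : d ≤ t) :
    ((window m p d).card : ℝ) ≤ (1 + p) * (p ^ d * m) := by
  rw [h.card_window]
  have h1 := Int.floor_le (p ^ d * m / 2)
  have h2 := h.one_le hd
  linarith

theorem le_card_window (h : IsParam t m p) {d : ℕ} (hd : d ≤ t) :
    (1 - 2 * p) * (p ^ d * m) ≤ ((window m p d).card : ℝ) := by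
  rw [h.card_window]
  have h1 := Int.lt_floor_add_one (p ^ d * m / 2)
  have h2 := h.one_le hd
  linarith

/-- Integrality gives `m ≤ 2 * ⌊m / 2⌋ + 1` with no error term, so the initial density is at most `n
/ m`. -/
theorem le_card_window_zero (h : IsParam t m p) : (m : ℝ) ≤ ((window m p 0).card : ℝ) := by
  rw [h.card_window]
  have h1 := Int.lt_floor_add_one (p ^ 0 * m / 2)
  set F := ⌊p ^ 0 * m / 2⌋
  have h2 : (m : ℝ) < 2 * F + 2 := by linarith
  have h3 : (m : ℤ) < 2 * F + 2 := by exact_mod_cast h2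
  have h4 : (m : ℤ) ≤ 2 * F + 1 := by omega
  exact_mod_cast h4

theorem le_card_filter_window (h : IsParam t m p) {d : ℕ} (hd : d < t) {x : ℤ}
    (hx : x ∈ window m p (d + 1)) :
    (1 - 2 * p) * (p ^ d * m)
      ≤ (((window m p d).filter fun y => x - y ∈ window m p d).card : ℝ) := by
  rw [mem_window, threshold_eq, pow_succ] at hx
  have h1 := Int.lt_floor_add_one (p ^ d * m / 2)
  have h2 := h.one_le hd.le
  simp only [window, threshold_eq, Finset.mem_Icc]
  set F := ⌊p ^ d * m / 2⌋
  -- The admissible `y` form the overlap of `[-F, F]` with its translate by `x`, which loses `|x|`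
  -- integers.
  have hsub : ∃ a b : ℤ, Finset.Icc a b ⊆ ((Finset.Icc (-F) F).filter
      fun y => -F ≤ x - y ∧ x - y ≤ F) ∧ b + 1 - a = 2 * F + 1 - |x| := by
    rcases le_total 0 x with h0 | h0
    · refine ⟨x - F, F, fun y hy => ?_, by rw [abs_of_nonneg h0]; ring⟩
      simp only [Finset.mem_filter, Finset.mem_Icc] at hy ⊢
      omega
    · refine ⟨-F, x + F, fun y hy => ?_, by rw [abs_of_nonpos h0]; ring⟩
      simp only [Finset.mem_filter, Finset.mem_Icc] at hy ⊢
      omega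
  obtain ⟨a, b, hab, hc⟩ := hsub
  have h3 := Finset.card_le_card hab
  rw [Int.card_Icc, hc] at h3
  have h4 : 2 * F + 1 - |x| ≤ (((Finset.Icc (-F) F).filter
      fun y => -F ≤ x - y ∧ x - y ≤ F).card : ℤ) :=
    (Int.self_le_toNat _).trans (by exact_mod_cast h3)
  have h5 : (2 * F + 1 - ((|x| : ℤ) : ℝ)) ≤ (((Finset.Icc (-F) F).filter
      fun y => -F ≤ x - y ∧ x - y ≤ F).card : ℝ) := by exact_mod_cast h4
  linarith

end IsParam

/-- The bound `(c * r) ^ 2 ^ d / (s * p ^ (d + 1) * m)` on the density of a list at level `d`. -/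
noncomputable def density (m : ℕ) (p c r s : ℝ) (d : ℕ) : ℝ :=
  (c * r) ^ 2 ^ d / (s * (p ^ (d + 1) * m))

theorem density_mul {t m : ℕ} {p : ℝ} (h : IsParam t m p) (c r : ℝ) {s : ℝ} (hs : 0 < s) (d : ℕ) :
    density m p c r s d * (s * (p ^ d * m)) = (c * r) ^ 2 ^ d / p := by
  have hm : (0 : ℝ) < m := Nat.cast_pos.2 h.m_pos
  have hp := h.p_pos
  rw [density, pow_succ p]
  field_simp

/-- This is why `density` has its form: it solves the first-moment recursion exactly, with `s` the
relative error of the window size and `r` free to fit the initial value. -/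
theorem density_sq_mul {t m : ℕ} {p : ℝ} (h : IsParam t m p) (c r : ℝ) {s : ℝ} (hs : 0 < s)
    (d : ℕ) : density m p c r s d ^ 2 * (s * (p ^ d * m)) = density m p c r s (d + 1) := by
  have hm : (0 : ℝ) < m := Nat.cast_pos.2 h.m_pos
  have hp := h.p_pos
  rw [density, density, pow_succ 2 d, pow_mul]
  field_simp
  ring

theorem density_nonneg {t m : ℕ} {p : ℝ} (h : IsParam t m p) {c r s : ℝ} (hc : 0 ≤ c) (hr : 0 ≤ r)
    (hs : 0 < s) (d : ℕ) : 0 ≤ density m p c r s d := by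
  have hp := h.p_pos
  rw [density]
  positivity

theorem density_last {t m : ℕ} {p : ℝ} (h : IsParam t m p) (c r s : ℝ) :
    density m p c r s t = (c * r) ^ 2 ^ t / s := by
  rw [density, h.pow_mul, mul_one]

/-! ### The recursion for the second-moment ratio -/

/-- A bound on the ratio between the second moments, without the contribution of equal index
tuples, and the squares of the first moments. -/
noncomputable def pairRatio (p c : ℝ) : ℕ → ℝ
  | 0 => 1
  | d + 1 => pairRatio p c d ^ 2 + 2 * pairRatio p c d * (p / c ^ 2 ^ d)

theorem pairRatio_nonneg {p c : ℝ} (hp : 0 ≤ p) (hc : 0 ≤ c) (d : ℕ) : 0 ≤ pairRatio p c d := by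
  induction d with
  | zero => simp [pairRatio]
  | succ d ih => rw [pairRatio]; positivity

theorem two_pow_succ_sub_one (d : ℕ) : 2 ^ (d + 1) - 1 = 2 * (2 ^ d - 1) + 1 := by
  have := Nat.one_le_two_pow (n := d)
  rw [pow_succ]
  omega

/-- For `c ≥ 1` the loss `p / c ^ 2 ^ d` is largest at the bottom. Bounding it by `p / c`
everywhere, each step squares the bound and multiplies it by at most `(1 + p / c) ^ 2`. -/
theorem pairRatio_le_of_one_le {p c : ℝ} (hp : 0 ≤ p) (hc : 1 ≤ c) (d : ℕ) :
    pairRatio p c d ≤ ((1 + p / c) ^ (2 ^ d - 1)) ^ 2 := by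
  have hr : 0 ≤ p / c := by positivity
  induction d with
  | zero => simp [pairRatio]
  | succ d ih =>
    have h0 := pairRatio_nonneg hp (zero_le_one.trans hc) d
    have h1 : p / c ^ 2 ^ d ≤ p / c := by
      gcongr
      exact le_self_pow₀ hc (by positivity)
    rw [pairRatio, two_pow_succ_sub_one]
    set B := ((1 + p / c) ^ (2 ^ d - 1)) ^ 2
    have hB : 1 ≤ B := one_le_pow₀ (one_le_pow₀ (by linarith))
    calc _ ≤ B ^ 2 + 2 * B * (p / c) := by gcongr
      _ ≤ B ^ 2 * (1 + p / c) ^ 2 := by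
        have h2 : 0 ≤ p / c * p / c * B ^ 2 := by positivity
        have h3 : 0 ≤ p / c * B * (B - 1) :=
          mul_nonneg (mul_nonneg hr (zero_le_one.trans hB)) (sub_nonneg.2 hB)
        have h4 : B ^ 2 * (1 + p / c) ^ 2
          = B ^ 2 + 2 * B * (p / c) + 2 * (p / c * B * (B - 1)) + p / c * p / c * B ^ 2 := by ring
        linarith
      _ = _ := by simp only [B]; ring

/-- For `c ≤ 1` the losses grow with `d`. Powers of `1 / c` are attached only to the excess over
`1`, so that in the end `c ^ (-k)` enters additively. -/
theorem pairRatio_le_of_le_one {p c : ℝ} (hp : 0 ≤ p) (hc0 : 0 < c) (hc : c ≤ 1) (d : ℕ) :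
    pairRatio p c d ≤ 1 + (1 / c) ^ (2 ^ d - 1) * (((1 + p) ^ (2 ^ d - 1)) ^ 2 - 1) := by
  induction d with
  | zero => simp [pairRatio]
  | succ d ih =>
    have h0 := pairRatio_nonneg hp hc0.le d
    have hw : 1 ≤ 1 / c := by rw [le_div_iff₀ hc0]; linarith
    have h1 : p / c ^ 2 ^ d = (1 / c) * (1 / c) ^ (2 ^ d - 1) * p := by
      rw [← pow_succ', Nat.sub_add_cancel Nat.one_le_two_pow, one_div_pow]
      ring
    rw [pairRatio, two_pow_succ_sub_one, h1, pow_succ (1 / c), mul_comm 2 (2 ^ d - 1),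
      pow_mul (1 / c)]
    have h2 : ((1 + p) ^ ((2 ^ d - 1) * 2 + 1)) ^ 2
        = (((1 + p) ^ (2 ^ d - 1)) ^ 2) ^ 2 * (1 + p) ^ 2 := by ring
    rw [h2]
    set w := 1 / c
    set V := w ^ (2 ^ d - 1)
    set E := ((1 + p) ^ (2 ^ d - 1)) ^ 2
    have hV : 1 ≤ V := one_le_pow₀ hw
    have hE : 1 ≤ E := one_le_pow₀ (one_le_pow₀ (by linarith))
    have hwV : 1 ≤ w * V := one_le_mul_of_one_le_of_one_le hw hV
    clear_value E
    obtain ⟨e, rfl⟩ : ∃ e, E = 1 + e := ⟨E - 1, by ring⟩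
    have he : 0 ≤ e := by linarith
    rw [add_sub_cancel_left] at ih
    -- As `V`, `V ^ 2` and `w * V` are at most `V ^ 2 * w`, everything beyond the leading `1` can be
    -- charged to `V ^ 2 * w`.
    have hVV : V ≤ V ^ 2 * w := by nlinarith
    have hVV' : V ^ 2 ≤ V ^ 2 * w := by nlinarith
    have hwVV : w * V ≤ V ^ 2 * w := by nlinarith
    calc _ ≤ (1 + V * e) ^ 2 + 2 * (1 + V * e) * (w * V * p) := by gcongr
      _ = 1 + 2 * e * V + e ^ 2 * V ^ 2 + 2 * p * (w * V) + 2 * e * p * (V ^ 2 * w) := by ring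
      _ ≤ 1 + 2 * e * (V ^ 2 * w) + e ^ 2 * (V ^ 2 * w) + 2 * p * (V ^ 2 * w)
          + 2 * e * p * (V ^ 2 * w) := by gcongr
      _ = 1 + V ^ 2 * w * ((1 + e) ^ 2 + 2 * (1 + e) * p - 1) := by ring
      _ ≤ 1 + V ^ 2 * w * ((1 + e) ^ 2 * (1 + p) ^ 2 - 1) := by
        have : (1 + e) ^ 2 + 2 * (1 + e) * p ≤ (1 + e) ^ 2 * (1 + p) ^ 2 := by
          have h5 : 0 ≤ e * p := by positivity
          have h6 : 0 ≤ ((1 + e) * p) ^ 2 := by positivity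
          have h7 : 0 ≤ e * e * p := by positivity
          nlinarith
        gcongr

theorem pairRatio_add_le {p c : ℝ} {t n : ℕ} (hk4 : 4 ≤ 2 ^ t) (hn : 1 ≤ n) (hp : 0 < p)
    (hc : c = p * n) :
    pairRatio p c t + (c ^ 2 ^ t)⁻¹
      ≤ ((c ^ 2 ^ t)⁻¹ + (1 + (2 : ℝ) ^ t / n) ^ 2 ^ t) * ((1 + p) ^ 2 ^ t) ^ 2 := by
  have hnR : (0 : ℝ) < n := by exact_mod_cast hn
  have hn1 : (1 : ℝ) ≤ n := by exact_mod_cast hn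
  have hc0 : 0 < c := by rw [hc]; positivity
  have hE : 1 ≤ ((1 + p) ^ 2 ^ t) ^ 2 := one_le_pow₀ (one_le_pow₀ (by linarith))
  have hF : 1 ≤ (1 + (2 : ℝ) ^ t / n) ^ 2 ^ t := one_le_pow₀ (by
    have : (0 : ℝ) ≤ 2 ^ t / n := by positivity
    linarith)
  have hw0 : 0 < (c ^ 2 ^ t)⁻¹ := by positivity
  rcases le_total 1 c with h1 | h1
  · have h2 := pairRatio_le_of_one_le hp.le h1 t
    have h3 : p / c = 1 / n := by rw [hc]; field_simp
    rw [h3] at h2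
    have hk4' : (4 : ℝ) ≤ 2 ^ t := by exact_mod_cast hk4
    have h4 : ((1 + 1 / (n : ℝ)) ^ (2 ^ t - 1)) ^ 2 ≤ (1 + (2 : ℝ) ^ t / n) ^ 2 ^ t := by
      -- Here `k ≥ 4` enters: `(1 + 1/n)^2 ≤ 1 + 3/n ≤ 1 + k/n`.
      have hin : 0 < 1 / (n : ℝ) := by positivity
      calc _ ≤ ((1 + 1 / (n : ℝ)) ^ 2 ^ t) ^ 2 := by
            gcongr
            · linarith
            · omega
        _ = ((1 + 1 / (n : ℝ)) ^ 2) ^ 2 ^ t := by rw [← pow_mul, ← pow_mul, mul_comm]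
        _ ≤ _ := by
          refine pow_le_pow_left₀ (by positivity) ?_ _
          have h5 : 1 / (n : ℝ) ≤ 1 := by rw [div_le_one hnR]; exact hn1
          have h6 : (2 : ℝ) ^ t / n = 2 ^ t * (1 / n) := by ring
          rw [h6]
          nlinarith
    nlinarith
  · have h2 := pairRatio_le_of_le_one hp.le hc0 h1 t
    have hw : 1 ≤ 1 / c := by rw [le_div_iff₀ hc0]; linarith
    have h3 : (1 / c) ^ (2 ^ t - 1) ≤ (c ^ 2 ^ t)⁻¹ := by
      rw [← one_div, ← one_div_pow]
      exact pow_le_pow_right₀ hw (by omega)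
    have h4 : ((1 + p) ^ (2 ^ t - 1)) ^ 2 ≤ ((1 + p) ^ 2 ^ t) ^ 2 := by
      gcongr
      · linarith
      · omega
    have h5 : 1 ≤ ((1 + p) ^ (2 ^ t - 1)) ^ 2 := one_le_pow₀ (one_le_pow₀ (by linarith))
    have h6 := mul_le_mul h3 (sub_le_sub_right h4 1) (by linarith) hw0.le
    nlinarith

/-! ### Success probability and expected list sizes -/

namespace IsUniformInput

variable {Ω : Type*} [MeasurableSpace Ω] {P : Measure Ω} [IsProbabilityMeasure P] {m t n : ℕ}
  {L : Fin (2 ^ t) → Fin n → Ω → ℤ} {p c : ℝ}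

theorem div_card_window_le (hpar : IsParam t m p) (hc : c = p * n) :
    n / ((window m p 0).card : ℝ) ≤ density m p c (1 + p) (1 + p) 0 := by
  have hm : (0 : ℝ) < m := Nat.cast_pos.2 hpar.m_pos
  have hp := hpar.p_pos
  have h1 : density m p c (1 + p) (1 + p) 0 = n / m := by
    rw [density, hc, pow_zero, pow_one, zero_add, pow_one]
    field_simp
  rw [h1]
  exact div_le_div_of_nonneg_left (Nat.cast_nonneg _) hm hpar.le_card_window_zero

/-- In `r = (1 - 2p)^2` one factor cancels `s`; the other pays for a window of up to `(1 + p) m`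
integers, since `(1 - 2p)(1 + p) ≤ 1`. -/
theorem le_div_card_window (hpar : IsParam t m p) (hc : c = p * n) :
    density m p c ((1 - 2 * p) ^ 2) (1 - 2 * p) 0 ≤ n / ((window m p 0).card : ℝ) := by
  have hm : (0 : ℝ) < m := Nat.cast_pos.2 hpar.m_pos
  have hp := hpar.p_pos
  have hq : 0 < 1 - 2 * p := by linarith [hpar.p_lt]
  have h1 : density m p c ((1 - 2 * p) ^ 2) (1 - 2 * p) 0 = n * (1 - 2 * p) / m := by
    rw [density, hc, pow_zero, pow_one, zero_add, pow_one]
    field_simp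
  have h2 := hpar.card_window_le (Nat.zero_le t)
  have h3 := hpar.le_card_window_zero
  have h4 : (0 : ℝ) < (window m p 0).card := hm.trans_le h3
  rw [pow_zero, one_mul] at h2
  rw [h1, div_le_div_iff₀ hm h4, mul_assoc]
  refine mul_le_mul_of_nonneg_left ?_ (Nat.cast_nonneg _)
  calc (1 - 2 * p) * (window m p 0).card ≤ (1 - 2 * p) * ((1 + p) * m) := by gcongr
    _ = m - m * (p + 2 * p ^ 2) := by ring
    _ ≤ m := by
      have : 0 ≤ m * (p + 2 * p ^ 2) := by positivity
      linarith

theorem integral_count_le_density (h : IsUniformInput P m L) (hpar : IsParam t m p)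
    (hc : c = p * n) (d i : ℕ) (hi : (i + 1) * 2 ^ d ≤ 2 ^ t) (x : ℤ) :
    ∫ ω, count m p L d i x ω ∂P ≤ density m p c (1 + p) (1 + p) d := by
  have hp := hpar.p_pos
  have hc0 : 0 ≤ c := by rw [hc]; positivity
  exact h.integral_count_le p (M := fun d => (1 + p) * (p ^ d * m))
    (fun d hd => hpar.card_window_le hd.le)
    (density_nonneg hpar hc0 (by linarith) (by linarith)) (div_card_window_le hpar hc)
    (fun d _ => (density_sq_mul hpar c (1 + p) (by linarith) d).le) d i hi x

theorem density_le_integral_count (h : IsUniformInput P m L) (hpar : IsParam t m p)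
    (hc : c = p * n) (d i : ℕ) (hi : (i + 1) * 2 ^ d ≤ 2 ^ t) (x : ℤ) (hx : x ∈ window m p d) :
    density m p c ((1 - 2 * p) ^ 2) (1 - 2 * p) d ≤ ∫ ω, count m p L d i x ω ∂P := by
  have hp := hpar.p_pos
  have hq : 0 < 1 - 2 * p := by linarith [hpar.p_lt]
  have hc0 : 0 ≤ c := by rw [hc]; positivity
  exact h.le_integral_count p (K := fun d => (1 - 2 * p) * (p ^ d * m))
    (density_nonneg hpar hc0 (sq_nonneg _) hq)
    (fun d hd x hx => hpar.le_card_filter_window hd hx) (le_div_card_window hpar hc)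
    (fun d _ => (density_sq_mul hpar c _ hq d).ge) d i hi x hx

theorem integral_count_sq_le (h : IsUniformInput P m L) (hpar : IsParam t m p) (hn : 1 ≤ n)
    (hc : c = p * n) :
    ∫ ω, count m p L t 0 0 ω * count m p L t 0 0 ω ∂P
      ≤ pairRatio p c t * density m p c (1 + p) (1 + p) t ^ 2
        + density m p c (1 + p) (1 + p) t := by
  have hp := hpar.p_pos
  have hnR : (0 : ℝ) < n := by exact_mod_cast hn
  have hc0 : 0 < c := by rw [hc]; positivity
  have hδ := density_nonneg hpar hc0.le (r := 1 + p) (s := 1 + p) (by linarith) (by linarith)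
  set δ := density m p c (1 + p) (1 + p)
  have hmain := h.integral_count_mul_le p (M := fun d => (1 + p) * (p ^ d * m))
    (α := fun d => pairRatio p c d * δ d ^ 2)
    (fun d hd => hpar.card_window_le hd.le) hδ (div_card_window_le hpar hc)
    (fun d _ => (density_sq_mul hpar c (1 + p) (by linarith) d).le)
    (fun d => mul_nonneg (pairRatio_nonneg hp.le hc0.le d) (sq_nonneg _))
    (by
      have := div_card_window_le hpar hc
      simp only [pairRatio, one_mul]
      gcongr)
    (by
      intro d _
      have h1 : δ d ^ 2 * ((1 + p) * (p ^ d * m)) = δ (d + 1) :=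
        density_sq_mul hpar c (1 + p) (by linarith) d
      have h2 : δ d * ((1 + p) * (p ^ d * m)) = (c * (1 + p)) ^ 2 ^ d / p :=
        density_mul hpar c (1 + p) (by linarith) d
      have hρ := pairRatio_nonneg hp.le hc0.le d
      simp only [pairRatio]
      rw [← h1]
      have hδd := hδ d
      have hMd : 0 ≤ (1 + p) * (p ^ d * m) := by positivity
      generalize (1 + p) * (p ^ d * m) = M at h1 h2 hMd
      generalize pairRatio p c d = ρ at hρ
      -- The mixed term is `2ρδ³M = 2ρ(δ²M)² / (δM)`, and `δM` is at least `c^(2^d) / p`; this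
      -- yields the summand `2ρ p / c^(2^d)` of `pairRatio`.
      have h3 : 1 ≤ p / c ^ 2 ^ d * (δ d * M) := by
        rw [h2, mul_pow]
        have : p / c ^ 2 ^ d * (c ^ 2 ^ d * (1 + p) ^ 2 ^ d / p) = (1 + p) ^ 2 ^ d := by
          field_simp
        rw [this]
        exact one_le_pow₀ (by linarith)
      have h4 : 0 ≤ 2 * ρ * (δ d ^ 3 * M) := by positivity
      nlinarith [mul_le_mul_of_nonneg_left h3 h4])
    t 0 (by simp) 0 0
  rw [if_pos rfl] at hmain
  exact hmain.trans (add_le_add_right (h.integral_count_le_density hpar hc t 0 (by simp) 0) _)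

theorem prob_le (h : IsUniformInput P m L) (hpar : IsParam t m p) (hc : c = p * n) :
    P.real {ω | Succeeds m p fun i j => L i j ω} ≤ c ^ 2 ^ t * (1 + 37 * p) ^ 2 ^ t := by
  have hp := hpar.p_pos
  have hc0 : 0 ≤ c := by rw [hc]; positivity
  refine (h.le_first_moment p).trans
    ((h.integral_count_le_density hpar hc t 0 (by simp) 0).trans ?_)
  rw [density_last hpar, ← mul_pow]
  refine (div_le_self (by positivity) (by linarith)).trans ?_
  gcongr
  linarith

theorem le_prob (h : IsUniformInput P m L) (hpar : IsParam t m p) (hk4 : 4 ≤ 2 ^ t) (hn : 1 ≤ n)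
    (hc : c = p * n) :
    1 / ((c ^ 2 ^ t)⁻¹ + (1 + (2 : ℝ) ^ t / n) ^ 2 ^ t) * (max 0 (1 - 150 * p)) ^ 2 ^ t
      ≤ P.real {ω | Succeeds m p fun i j => L i j ω} := by
  have hp := hpar.p_pos
  have hnR : (0 : ℝ) < n := by exact_mod_cast hn
  have hc0 : 0 < c := by rw [hc]; positivity
  rcases le_total (1 - 150 * p) 0 with hneg | hpos
  · rw [max_eq_left hneg, zero_pow (by positivity), mul_zero]
    exact measureReal_nonneg
  rw [max_eq_right hpos]
  have hq : 0 < 1 - 2 * p := by linarith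
  set R := (c ^ 2 ^ t)⁻¹ + (1 + (2 : ℝ) ^ t / n) ^ 2 ^ t
  have hR : 0 < R := by positivity
  have h1 : (c * (1 - 2 * p) ^ 2) ^ 2 ^ t ≤ ∫ ω, count m p L t 0 0 ω ∂P := by
    refine le_trans ?_ (h.density_le_integral_count hpar hc t 0 (by simp) 0 ?_)
    · rw [density_last hpar]
      exact le_div_self (by positivity) hq (by linarith)
    · rw [mem_window, threshold_eq]
      simp
      positivity
  have h2 : ∫ ω, count m p L t 0 0 ω * count m p L t 0 0 ω ∂P
      ≤ (c ^ 2 ^ t) ^ 2 * ((1 + p) ^ 4) ^ 2 ^ t * R := by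
    refine (h.integral_count_sq_le hpar hn hc).trans ?_
    have hδ : density m p c (1 + p) (1 + p) t ≤ c ^ 2 ^ t * (1 + p) ^ 2 ^ t := by
      rw [density_last hpar, ← mul_pow]
      exact div_le_self (by positivity) (by linarith)
    have hδ0 := density_nonneg hpar hc0.le (r := 1 + p) (s := 1 + p) (by linarith)
      (by linarith) t
    have hρ := pairRatio_nonneg hp.le hc0.le t
    have hE : 1 ≤ (1 + p) ^ 2 ^ t := one_le_pow₀ (by linarith)
    calc _ ≤ pairRatio p c t * (c ^ 2 ^ t * (1 + p) ^ 2 ^ t) ^ 2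
          + c ^ 2 ^ t * (1 + p) ^ 2 ^ t := by gcongr
      _ ≤ pairRatio p c t * (c ^ 2 ^ t * (1 + p) ^ 2 ^ t) ^ 2
          + c ^ 2 ^ t * ((1 + p) ^ 2 ^ t) ^ 2 := by
        gcongr
        exact le_self_pow₀ hE two_ne_zero
      _ = (c ^ 2 ^ t) ^ 2 * ((1 + p) ^ 2 ^ t) ^ 2 * (pairRatio p c t + (c ^ 2 ^ t)⁻¹) := by
        field_simp
      _ ≤ (c ^ 2 ^ t) ^ 2 * ((1 + p) ^ 2 ^ t) ^ 2 * (R * ((1 + p) ^ 2 ^ t) ^ 2) := by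
        gcongr
        exact pairRatio_add_le hk4 hn hp hc
      _ = _ := by rw [← pow_mul (1 + p) 4, mul_comm 4, pow_mul]; ring
  refine le_trans ?_ (h.second_moment_le p (by positivity) (by positivity) h1 h2)
  -- The squared first moment contributes `(1 - 2p)^4` and the second moment `(1 + p)^4` to the base
  -- of the `k`-th power; `150` is a generous bound for the quotient.
  have h3 : (1 - 150 * p) * (1 + p) ^ 4 ≤ (1 - 2 * p) ^ 4 := by
    have h4 := one_add_mul_le_pow (a := -(2 * p)) (by linarith) 4
    have h5 : (1 + p) ^ 4 ≤ 1 + 5 * p := by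
      have hp1 : p ≤ 1 / 150 := by linarith
      have hp2 : p ^ 2 ≤ p * (1 / 150) := by nlinarith
      have hp3 : p ^ 3 ≤ p * (1 / 150) := by nlinarith [sq_nonneg p]
      have hp4 : p ^ 4 ≤ p * (1 / 150) := by nlinarith [sq_nonneg (p ^ 2), sq_nonneg p]
      nlinarith
    have h6 : 1 + (-(2 * p)) = 1 - 2 * p := by ring
    rw [h6] at h4
    push_cast at h4
    nlinarith
  have h7 := pow_le_pow_left₀ (by positivity) h3 (2 ^ t)
  rw [mul_pow] at h7
  rw [le_div_iff₀ (by positivity), mul_pow c]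
  calc _ = (c ^ 2 ^ t) ^ 2 * ((1 - 150 * p) ^ 2 ^ t * ((1 + p) ^ 4) ^ 2 ^ t) := by
        field_simp
    _ ≤ (c ^ 2 ^ t) ^ 2 * ((1 - 2 * p) ^ 4) ^ 2 ^ t := by gcongr
    _ = _ := by
      have h8 : ((1 - 2 * p) ^ 4) ^ 2 ^ t = (((1 - 2 * p) ^ 2) ^ 2 ^ t) ^ 2 := by
        rw [← pow_mul, ← pow_mul, ← pow_mul]
        congr 1
        ring
      rw [h8, ← mul_pow]

theorem integral_length_le (h : IsUniformInput P m L) (hpar : IsParam t m p) (hc : c = p * n)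
    {d i : ℕ} (hd : d ≤ t) (hi : (i + 1) * 2 ^ d ≤ 2 ^ t) :
    ∫ ω, ((level m p (fun a j => L a j ω) d i).length : ℝ) ∂P
      ≤ n * c ^ (2 ^ d - 1) * (1 + p) ^ 2 ^ d := by
  have hp := hpar.p_pos
  have hc0 : 0 ≤ c := by rw [hc]; positivity
  rw [h.integral_length]
  calc _ ≤ ∑ x ∈ window m p d, density m p c (1 + p) (1 + p) d :=
        Finset.sum_le_sum fun x _ => h.integral_count_le_density hpar hc d i hi x
    _ = density m p c (1 + p) (1 + p) d * (window m p d).card := by simp; ring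
    _ ≤ density m p c (1 + p) (1 + p) d * ((1 + p) * (p ^ d * m)) :=
      mul_le_mul_of_nonneg_left (hpar.card_window_le hd)
        (density_nonneg hpar hc0 (by linarith) (by linarith) d)
    _ = c ^ 2 ^ d * (1 + p) ^ 2 ^ d / p := by
      rw [density_mul hpar c _ (by linarith), mul_pow]
    _ = _ := by
      rw [← Nat.sub_add_cancel (Nat.one_le_two_pow (n := d)), pow_succ c, Nat.add_sub_cancel]
      -- Trading one factor `c` for `p * n` cancels the division by `p` and leaves the exponent `2 ^
      -- d - 1`.
      nth_rewrite 2 [hc]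
      field_simp

theorem le_integral_length (h : IsUniformInput P m L) (hpar : IsParam t m p) (hc : c = p * n)
    {d i : ℕ} (hd : d ≤ t) (hi : (i + 1) * 2 ^ d ≤ 2 ^ t) :
    n * c ^ (2 ^ d - 1) * ((1 - 2 * p) ^ 2) ^ 2 ^ d
      ≤ ∫ ω, ((level m p (fun a j => L a j ω) d i).length : ℝ) ∂P := by
  have hp := hpar.p_pos
  have hq : 0 < 1 - 2 * p := by linarith [hpar.p_lt]
  have hc0 : 0 ≤ c := by rw [hc]; positivity
  rw [h.integral_length]
  refine ge_iff_le.1 ?_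
  calc _ ≥ ∑ x ∈ window m p d, density m p c ((1 - 2 * p) ^ 2) (1 - 2 * p) d :=
        Finset.sum_le_sum fun x hx => h.density_le_integral_count hpar hc d i hi x hx
    _ = density m p c ((1 - 2 * p) ^ 2) (1 - 2 * p) d * (window m p d).card := by simp; ring
    _ ≥ density m p c ((1 - 2 * p) ^ 2) (1 - 2 * p) d * ((1 - 2 * p) * (p ^ d * m)) :=
      mul_le_mul_of_nonneg_left (hpar.le_card_window hd)
        (density_nonneg hpar hc0 (sq_nonneg _) hq d)
    _ = c ^ 2 ^ d * ((1 - 2 * p) ^ 2) ^ 2 ^ d / p := by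
      rw [density_mul hpar c _ hq, mul_pow]
    _ = _ := by
      rw [← Nat.sub_add_cancel (Nat.one_le_two_pow (n := d)), pow_succ c, Nat.add_sub_cancel]
      nth_rewrite 2 [hc]
      field_simp

theorem integrable_totalSize (h : IsUniformInput P m L) (p : ℝ) :
    Integrable (fun ω => (totalSize m p (fun i j => L i j ω) : ℝ)) P := by
  simp only [totalSize, Nat.cast_sum]
  exact integrable_finsetSum _ fun d _ => integrable_finsetSum _ fun i _ =>
    h.integrable_length p d i

theorem integral_totalSize (h : IsUniformInput P m L) (p : ℝ) :
    ∫ ω, (totalSize m p (fun i j => L i j ω) : ℝ) ∂P = (2 : ℝ) ^ t * n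
      + ∑ d ∈ Finset.Icc 1 t, ∑ i ∈ Finset.range (2 ^ t / 2 ^ d),
        ∫ ω, ((level m p (fun a j => L a j ω) d i).length : ℝ) ∂P := by
  simp only [totalSize, Nat.cast_sum]
  rw [integral_finsetSum _ fun d _ => integrable_finsetSum _ fun i _ => h.integrable_length p d i]
  simp_rw [integral_finsetSum _ fun i _ => h.integrable_length p _ i]
  rw [Finset.range_eq_Ico, Finset.sum_eq_sum_Ico_succ_bot t.succ_pos]
  congr 1
  rw [pow_zero, Nat.div_one]
  have h0 : ∀ i ∈ Finset.range (2 ^ t),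
      ∫ ω, ((level m p (fun a j => L a j ω) 0 i).length : ℝ) ∂P = n := by
    intro i hi
    simp_rw [length_level_zero _ (Finset.mem_range.1 hi)]
    simp
  rw [Finset.sum_congr rfl h0]
  simp

theorem integral_totalSize_le (h : IsUniformInput P m L) (hpar : IsParam t m p) (ht : 1 ≤ t)
    (hc : c = p * n) :
    ∫ ω, (totalSize m p (fun i j => L i j ω) : ℝ) ∂P
      ≤ (2 : ℝ) ^ t * n * (1 + ∑ d ∈ Finset.Icc 1 t, c ^ (2 ^ d - 1) / (2 : ℝ) ^ d)
          * (1 + 37 * p) ^ (2 ^ t - 1) := by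
  have hp := hpar.p_pos
  have hc0 : 0 ≤ c := by rw [hc]; positivity
  have h2t : 2 ≤ 2 ^ t := Nat.le_self_pow (by omega) 2
  set Z := (1 + 37 * p) ^ (2 ^ t - 1)
  have hZ : 1 ≤ Z := one_le_pow₀ (by linarith)
  rw [h.integral_totalSize, mul_add, mul_one, add_mul, Finset.mul_sum, Finset.sum_mul]
  refine add_le_add (le_mul_of_one_le_right (by positivity) hZ) (Finset.sum_le_sum fun d hd => ?_)
  rw [Finset.mem_Icc] at hd
  have hdiv : ((2 ^ t / 2 ^ d : ℕ) : ℝ) = 2 ^ t / 2 ^ d := by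
    rw [Nat.cast_div (pow_dvd_pow 2 hd.2) (by positivity)]
    push_cast
    rfl
  -- The exponent `k - 1` suffices because `2^d ≤ k ≤ 2(k - 1)` and `(1 + p)^2 ≤ 1 + 37p`.
  have hpow : (1 + p) ^ 2 ^ d ≤ Z := by
    calc (1 + p) ^ 2 ^ d ≤ (1 + p) ^ (2 * (2 ^ t - 1)) := by
          refine pow_le_pow_right₀ (by linarith) ?_
          have : 2 ^ d ≤ 2 ^ t := Nat.pow_le_pow_right (by norm_num) hd.2
          omega
      _ = ((1 + p) ^ 2) ^ (2 ^ t - 1) := pow_mul _ _ _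
      _ ≤ _ := by
        refine pow_le_pow_left₀ (by positivity) ?_ _
        nlinarith [hpar.p_lt]
  calc _ ≤ ∑ i ∈ Finset.range (2 ^ t / 2 ^ d), n * c ^ (2 ^ d - 1) * (1 + p) ^ 2 ^ d := by
        refine Finset.sum_le_sum fun i hi => h.integral_length_le hpar hc hd.2 ?_
        exact (Nat.le_div_iff_mul_le (by positivity)).1 (Finset.mem_range.1 hi)
    _ = (2 : ℝ) ^ t * n * (c ^ (2 ^ d - 1) / (2 : ℝ) ^ d) * (1 + p) ^ 2 ^ d := by
      rw [Finset.sum_const, Finset.card_range, nsmul_eq_mul, hdiv]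
      ring
    _ ≤ _ := by gcongr

theorem le_integral_totalSize (h : IsUniformInput P m L) (hpar : IsParam t m p) (ht : 1 ≤ t)
    (hc : c = p * n) :
    (2 : ℝ) ^ t * n * (1 + ∑ d ∈ Finset.Icc 1 t, c ^ (2 ^ d - 1) / (2 : ℝ) ^ d)
        * (1 - 37 * p) ^ (2 ^ t - 1)
      ≤ ∫ ω, (totalSize m p (fun i j => L i j ω) : ℝ) ∂P := by
  have hp := hpar.p_pos
  have hc0 : 0 ≤ c := by rw [hc]; positivity
  have h2t : 2 ≤ 2 ^ t := Nat.le_self_pow (by omega) 2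
  have hq : 0 < 1 - 2 * p := by linarith [hpar.p_lt]
  rcases le_total (1 - 37 * p) 0 with hneg | hpos
  -- Since `p` is only known to be below `1/30`, `1 - 37p` may be negative; the exponent `k - 1`
  -- being odd, the lower bound is then nonpositive.
  · have hodd : Odd (2 ^ t - 1) := by
      obtain ⟨s, rfl⟩ : ∃ s, t = s + 1 := ⟨t - 1, by omega⟩
      exact ⟨2 ^ s - 1, two_pow_succ_sub_one s⟩
    refine (mul_nonpos_of_nonneg_of_nonpos (by positivity) (hodd.pow_nonpos hneg)).trans ?_
    exact integral_nonneg fun ω => Nat.cast_nonneg _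
  set Z := (1 - 37 * p) ^ (2 ^ t - 1)
  have hZ : Z ≤ 1 := pow_le_one₀ hpos (by linarith)
  rw [h.integral_totalSize, mul_add, mul_one, add_mul, Finset.mul_sum, Finset.sum_mul]
  refine add_le_add (mul_le_of_le_one_right (by positivity) hZ) (Finset.sum_le_sum fun d hd => ?_)
  rw [Finset.mem_Icc] at hd
  have hdiv : ((2 ^ t / 2 ^ d : ℕ) : ℝ) = 2 ^ t / 2 ^ d := by
    rw [Nat.cast_div (pow_dvd_pow 2 hd.2) (by positivity)]
    push_cast
    rfl
  have hpow : Z ≤ ((1 - 2 * p) ^ 2) ^ 2 ^ d := by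
    calc Z ≤ (((1 - 2 * p) ^ 2) ^ 2) ^ (2 ^ t - 1) := by
          refine pow_le_pow_left₀ hpos ?_ _
          have h1 := one_add_mul_le_pow (a := -(2 * p)) (by linarith) 4
          rw [← pow_mul, sub_eq_add_neg 1 (2 * p), show 2 * 2 = 4 from rfl]
          push_cast at h1
          linarith
      _ = ((1 - 2 * p) ^ 2) ^ (2 * (2 ^ t - 1)) := (pow_mul _ _ _).symm
      _ ≤ _ := by
        refine pow_le_pow_of_le_one (by positivity) (pow_le_one₀ hq.le (by linarith)) ?_
        have : 2 ^ d ≤ 2 ^ t := Nat.pow_le_pow_right (by norm_num) hd.2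
        omega
  calc _ ≤ (2 : ℝ) ^ t * n * (c ^ (2 ^ d - 1) / (2 : ℝ) ^ d) * ((1 - 2 * p) ^ 2) ^ 2 ^ d := by
        gcongr
    _ = ∑ i ∈ Finset.range (2 ^ t / 2 ^ d),
        n * c ^ (2 ^ d - 1) * ((1 - 2 * p) ^ 2) ^ 2 ^ d := by
      rw [Finset.sum_const, Finset.card_range, nsmul_eq_mul, hdiv]
      ring
    _ ≤ _ := by
      refine Finset.sum_le_sum fun i hi => h.le_integral_length hpar hc hd.2 ?_
      exact (Nat.le_div_iff_mul_le (by positivity)).1 (Finset.mem_range.1 hi)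

end IsUniformInput

end KTree

theorem theorem2p1 (k t n m : ℕ) (hk : k = 2 ^ t) (hk4 : 4 ≤ k) (hn : 1 ≤ n)
    (hm : 30 ^ (t + 1) < m)
    (p c : ℝ) (hp : p = (m : ℝ) ^ (-1 / ((t : ℝ) + 1))) (hc : c = p * n)
    {Ω : Type*} [MeasurableSpace Ω] (P : MeasureTheory.Measure Ω)
    [MeasureTheory.IsProbabilityMeasure P]
    (L : Fin (2 ^ t) → Fin n → Ω → ℤ)
    (hmeas : ∀ i j, Measurable (L i j))
    (hindep : ProbabilityTheory.iIndepFun (fun ij : Fin (2 ^ t) × Fin n => L ij.1 ij.2) P)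
    (hunif : ∀ i j, P.map (L i j) = ProbabilityTheory.uniformOn (KTree.intRange m)) :
    (1 / (c ^ (-(k : ℤ)) + (1 + (k : ℝ) / n) ^ k) * (max 0 (1 - 150 * p)) ^ k
        ≤ P.real {ω | KTree.Succeeds m p (fun i j => L i j ω)} ∧
      P.real {ω | KTree.Succeeds m p (fun i j => L i j ω)} ≤ c ^ k * (1 + 37 * p) ^ k) ∧
    (MeasureTheory.Integrable (fun ω => (KTree.totalSize m p (fun i j => L i j ω) : ℝ)) P ∧
      ∫ ω, (KTree.totalSize m p (fun i j => L i j ω) : ℝ) ∂P ∈ Set.Icc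
        ((k : ℝ) * n * (1 + ∑ d ∈ Finset.Icc 1 t, c ^ (2 ^ d - 1) / (2 : ℝ) ^ d)
          * (1 - 37 * p) ^ (k - 1))
        ((k : ℝ) * n * (1 + ∑ d ∈ Finset.Icc 1 t, c ^ (2 ^ d - 1) / (2 : ℝ) ^ d)
          * (1 + 37 * p) ^ (k - 1))) := by
  subst hk
  have h : KTree.IsUniformInput P m L := ⟨hmeas, hindep, hunif⟩
  have hpar : KTree.IsParam t m p := hp ▸ KTree.isParam_rpow hm
  have ht : 1 ≤ t := by
    by_contra h0
    rw [Nat.lt_one_iff.1 (not_le.1 h0)] at hk4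
    norm_num at hk4
  rw [zpow_neg, zpow_natCast]
  push_cast
  exact ⟨⟨h.le_prob hpar hk4 hn hc, h.prob_le hpar hc⟩, h.integrable_totalSize p,
    h.le_integral_totalSize hpar ht hc, h.integral_totalSize_le hpar ht hc⟩
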